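/- For an odd integer $m=2r+1$ with $r\ge 1$, let $I_m=\{-r,-(r-1),\dots,-1,0,1,\dots,r-1,r\}$. A perfect difference matrix PDM$(n,m)$ is an $n\times m$ matrix $D=(d_{ij})$ with entries in $I_m$ such that each row of $D$ contains every element of $I_m$ exactly once and, for any two rows $s<t$, the list of differences $(d_{tj}-d_{sj})_{1\le j\le m}$ contains every element of $I_m$ exactly once. Theorem. A PDM$(3,m)$ exists for every odd integer $m$ with $5\le m<1000$, except for $m=9$ and $m=11$, for which no PDM$(3,m)$ exists, and except possibly for the following 33 values, for which existence is not decided here: $m\in\{207, 219, 227, 243, 249, 251, 257, 263, 297, 303, 317, 319, 327, 331, 347, 363, 367, 369, 383, 401, 423, 431, 439, 587, 617, 641, 669, 717, 719, 789, 947, 971, 977\}$. -/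

import Mathlib

/-- For odd `m = 2 * r + 1`, the symmetric interval `I_m = {-r, …, -1, 0, 1, …, r}` of `m` integers
(here `m / 2 = r`). -/
def symmInterval (m : ℕ) : Set ℤ :=
  Set.Icc (-((m / 2 : ℕ) : ℤ)) ((m / 2 : ℕ) : ℤ)

/-- For odd `m`, an `n × m` integer matrix `D` is a perfect difference matrix PDM(n, m) if every row
runs through `I_m`, each element occurring exactly once, and so does the difference
`D t - D s` of any two rows `s < t`. -/
structure IsPerfectDifferenceMatrix (n m : ℕ) (D : Matrix (Fin n) (Fin m) ℤ) : Prop where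
  row : ∀ s : Fin n, Set.BijOn (fun j => D s j) Set.univ (symmInterval m)
  diff : ∀ s t : Fin n, s < t →
    Set.BijOn (fun j => D t j - D s j) Set.univ (symmInterval m)

/-- A PDM(n, m) exists. -/
def ExistsPDM (n m : ℕ) : Prop :=
  ∃ D : Matrix (Fin n) (Fin m) ℤ, IsPerfectDifferenceMatrix n m D

/-! Add a zero row to the matrix. A column becomes a quadruple `(0, a, b, c)`, and the row and
difference conditions merge into one: each of the six coordinate differences takes every value of
`I_m` exactly once. The order of the columns is irrelevant, so a matrix is a multiset of columns,
and the question becomes which multisets of integers are the common value multiset of the six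
difference maps (`Realizes`, `existsPDM_iff`). Differences are linear in the column, so realized
multisets are closed under union, dilation and sumset.

Existence. The sumset of `I_g` and `g * I_n` is `I_{gn}`, which gives products. If order `n` has a
solution with a zero column (`PointedOrder`), leaving that column out realizes `I_{gn}` without the
hole `I_g`. It remains to fill the hole, and one may at the same time add `±(L+1), …, ±(L+s)` with
`L = gn/2`, which yields order `gn + 2s`. The fillings are made of explicit columns, of dilated
smaller orders (cores), and of blocks: the set of all differences of four or five integers is
realized, because a sharply doubly transitive set of maps turns a block into columns. Fillings are
written with `L` as a symbol, so that one of them serves many `n`. All this is recorded as a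
computation on sets of known orders that is sound whatever the tables contain (`sound_all`); the
kernel then checks that the tables reach every claimed order (`covers_all`).

Nonexistence. A solution is an exact cover of the `6m` pairs (difference map, value) by columns. The
permutations of the four points and the reflection act on solutions, and some column must have first
entry `m / 2`. Excluding such columns orbit by orbit, each by an exhaustive search proved sound in
`not_isCover_of_refutes`, leaves none for `m = 9` and `m = 11`. -/

/-! ### Columns and the multisets of differences that they realize -/

/-- The six differences of the four points `0, c.1, c.2.1, c.2.2`. -/
def edges (c : ℤ × ℤ × ℤ) : Fin 6 → ℤ :=
  ![c.1, c.2.1, c.2.2, c.2.1 - c.1, c.2.2 - c.1, c.2.2 - c.2.1]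

theorem edges_add (c d : ℤ × ℤ × ℤ) (i : Fin 6) : edges (c + d) i = edges c i + edges d i := by
  fin_cases i <;> simp [edges] <;> ring

theorem edges_smul (k : ℤ) (c : ℤ × ℤ × ℤ) (i : Fin 6) : edges (k • c) i = k * edges c i := by
  fin_cases i <;> simp [edges] <;> ring

/-- A family of columns each of whose six difference maps takes exactly the values in `S`,
with multiplicity. -/
def Solves (K : Multiset (ℤ × ℤ × ℤ)) (S : Multiset ℤ) : Prop :=
  ∀ i, K.map (fun c => edges c i) = S

/-- `S` is the common multiset of values of the six difference maps on some family of columns. -/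
def Realizes (S : Multiset ℤ) : Prop :=
  ∃ K, Solves K S

theorem Realizes.zero : Realizes 0 := ⟨0, fun _ => rfl⟩

theorem Realizes.singleton_zero : Realizes {0} :=
  ⟨{0}, fun i => by fin_cases i <;> simp [edges]⟩

theorem Realizes.add {S T : Multiset ℤ} : Realizes S → Realizes T → Realizes (S + T) := by
  rintro ⟨K, hK⟩ ⟨K', hK'⟩
  exact ⟨K + K', fun i => by rw [Multiset.map_add, hK i, hK' i]⟩

theorem Realizes.smul (k : ℤ) {S : Multiset ℤ} :
    Realizes S → Realizes (S.map (fun a => k * a)) := by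
  rintro ⟨K, hK⟩
  refine ⟨K.map (fun c => k • c), fun i => ?_⟩
  rw [← hK i, Multiset.map_map, Multiset.map_map]
  exact Multiset.map_congr rfl fun c _ => edges_smul k c i

/-- Adding every column of one family to every column of the other works for all six maps at once,
since `edges` is additive. -/
theorem Realizes.bind {S T : Multiset ℤ} :
    Realizes S → Realizes T → Realizes (S.bind fun a => T.map (fun b => a + b)) := by
  rintro ⟨K, hK⟩ ⟨K', hK'⟩
  refine ⟨K.bind fun c => K'.map (fun d => c + d), fun i => ?_⟩
  rw [← hK i, Multiset.map_bind, Multiset.bind_map]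
  refine Multiset.bind_congr fun c _ => ?_
  rw [← hK' i, Multiset.map_map, Multiset.map_map]
  exact Multiset.map_congr rfl fun d _ => edges_add c d i

/-- The integers `d` with `|d| ≤ m / 2`. -/
noncomputable def interval (m : ℕ) : Finset ℤ :=
  Finset.Icc (-((m / 2 : ℕ) : ℤ)) ((m / 2 : ℕ) : ℤ)

theorem card_interval {m : ℕ} (hm : Odd m) : (interval m).card = m := by
  obtain ⟨r, rfl⟩ := hm
  simp only [interval, Int.card_Icc]
  omega

theorem bijOn_univ_iff {m : ℕ} (f : Fin m → ℤ) (T : Finset ℤ) :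
    Set.BijOn f Set.univ (T : Set ℤ) ↔ Finset.univ.val.map f = T.val := by
  constructor
  · intro h
    have hinj : Function.Injective f := Set.injOn_univ.1 h.injOn
    have himg : Finset.univ.map ⟨f, hinj⟩ = T := by
      ext d
      rw [← Finset.mem_coe (s := T), ← h.image_eq]
      simp
    rw [← himg, Finset.map_val]
    rfl
  · intro h
    have hmem : ∀ d, d ∈ T ↔ ∃ j, f j = d := fun d => by
      rw [← Finset.mem_val, ← h]; simp
    have hnd : (Finset.univ.val.map f).Nodup := h ▸ T.nodup
    refine ⟨fun j _ => (hmem _).2 ⟨j, rfl⟩, fun a _ b _ hab => ?_, fun d hd => ?_⟩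
    · exact Multiset.inj_on_of_nodup_map hnd a (Finset.mem_univ_val a) b (Finset.mem_univ_val b) hab
    · obtain ⟨j, hj⟩ := (hmem d).1 hd
      exact ⟨j, trivial, hj⟩

theorem coe_interval (m : ℕ) : (interval m : Set ℤ) = symmInterval m := by
  simp [interval, symmInterval]

theorem existsPDM_iff {m : ℕ} (hm : Odd m) : ExistsPDM 3 m ↔ Realizes (interval m).val := by
  constructor
  · rintro ⟨D, hrow, hdiff⟩
    refine ⟨Finset.univ.val.map fun j => (D 0 j, D 1 j, D 2 j), fun i => ?_⟩
    rw [Multiset.map_map, ← bijOn_univ_iff, coe_interval]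
    fin_cases i
    · exact hrow 0
    · exact hrow 1
    · exact hrow 2
    · exact hdiff 0 1 (by decide)
    · exact hdiff 0 2 (by decide)
    · exact hdiff 1 2 (by decide)
  · rintro ⟨K, hK⟩
    have hcard : K.toList.length = m := by
      rw [Multiset.length_toList, ← card_interval hm, Finset.card_def, ← hK 0, Multiset.card_map]
    have key : ∀ i, Set.BijOn (fun j : Fin m => edges (K.toList.get (j.cast hcard.symm)) i)
        Set.univ (symmInterval m) := fun i => by
      rw [← coe_interval, bijOn_univ_iff, ← hK i]
      conv_rhs => rw [← Multiset.coe_toList K, Multiset.map_coe, ← List.ofFn_get K.toList,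
        List.map_ofFn]
      subst hcard
      exact Fin.univ_val_map _
    refine ⟨fun s j => (fun c : ℤ × ℤ × ℤ => (![c.1, c.2.1, c.2.2] : Fin 3 → ℤ))
      (K.toList.get (j.cast hcard.symm)) s, ⟨fun s => ?_, fun s t hst => ?_⟩⟩
    · fin_cases s
      · exact key 0
      · exact key 1
      · exact key 2
    · fin_cases s <;> fin_cases t <;> first | (exact absurd hst (by decide)) | skip
      · exact key 3
      · exact key 4
      · exact key 5

/-- Counting replaces uniqueness: if every wanted value occurs and there is no room for more, each
occurs exactly once. -/
theorem Finset.val_eq_of_card_le {α : Type*} {T : Finset α} {S : Multiset α}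
    (hmem : ∀ t ∈ T, t ∈ S) (hcard : Multiset.card S ≤ T.card) : S = T.val :=
  (Multiset.eq_of_le_of_card_le
    ((Multiset.le_iff_subset T.nodup).2 fun t ht => hmem t ht) hcard).symm

theorem mem_interval {m : ℕ} {d : ℤ} :
    d ∈ interval m ↔ -((m / 2 : ℕ) : ℤ) ≤ d ∧ d ≤ ((m / 2 : ℕ) : ℤ) := Finset.mem_Icc

theorem zero_mem_interval (m : ℕ) : (0 : ℤ) ∈ interval m := by
  rw [mem_interval]; omega

/-! ### Perfect and pointed perfect orders -/

/-- `interval m` is realized. -/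
def PerfectOrder (m : ℕ) : Prop := Realizes (interval m).val

/-- The nonzero elements of `interval m` are realized, so that there is a perfect difference
matrix with a zero column. -/
def PointedOrder (m : ℕ) : Prop := Realizes ((interval m).erase 0).val

theorem PointedOrder.perfect {m : ℕ} (h : PointedOrder m) : PerfectOrder m := by
  have := Realizes.singleton_zero.add h
  rwa [Multiset.singleton_add, ← Finset.insert_val_of_notMem (Finset.notMem_erase _ _),
    Finset.insert_erase (zero_mem_interval m)] at this

/-- The empty family of columns. This degenerate case starts the recursion: with `n = 1`, an
extension yields order `g + 2 * s`. -/
theorem pointed_one : PointedOrder 1 := by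
  have : ((interval 1).erase 0).val = 0 := by
    rw [Finset.val_eq_zero]
    ext d
    simp only [Finset.mem_erase, mem_interval, Finset.notMem_empty, iff_false]
    omega
  rw [PointedOrder, this]
  exact Realizes.zero

/-! ### Inflation -/

theorem Realizes.inflate {g : ℕ} (hg : Odd g) {A T : Finset ℤ} (hA : Realizes A.val)
    (hgP : PerfectOrder g)
    (hcov : ∀ t ∈ T, ∃ q ∈ A, ∃ b ∈ interval g, t = g * q + b) (hcard : A.card * g ≤ T.card) :
    Realizes T.val := by
  have h := (hA.smul g).bind hgP
  refine Finset.val_eq_of_card_le (T := T) ?_ ?_ ▸ h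
  · intro t ht
    obtain ⟨q, hq, b, hb, rfl⟩ := hcov t ht
    simp only [Multiset.mem_bind, Multiset.mem_map]
    exact ⟨_, ⟨q, hq, rfl⟩, b, hb, rfl⟩
  · have hc : Multiset.card (interval g).val = g := card_interval hg
    simpa [Multiset.card_bind, hc] using hcard

/-- Division by `2 * h + 1` with the remainder centred at zero; the bound on `t` is exactly what
keeps the quotient within `±r`. -/
theorem exists_quotient (r h : ℕ) {t : ℤ} (ht : t ∈ interval ((2 * h + 1) * (2 * r + 1))) :
    ∃ q ∈ interval (2 * r + 1), ∃ b ∈ interval (2 * h + 1), t = (2 * h + 1 : ℕ) * q + b := by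
  have hL : (2 * h + 1) * (2 * r + 1) / 2 = (2 * h + 1) * r + h := by
    have : (2 * h + 1) * (2 * r + 1) = 2 * ((2 * h + 1) * r + h) + 1 := by ring
    omega
  rw [mem_interval, hL] at ht
  push_cast at ht
  have hh : (0 : ℤ) < 2 * h + 1 := by positivity
  -- Shifting by `h` before dividing, and subtracting `h` from the remainder afterwards, centres it.
  have h1 := Int.emod_add_mul_ediv (t + h) (2 * h + 1)
  have h2 := Int.emod_nonneg (t + h) hh.ne'
  have h3 := Int.emod_lt_of_pos (t + h) hh
  set q := (t + h) / (2 * h + 1)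
  set b := (t + h) % (2 * h + 1)
  refine ⟨q, ?_, b - h, ?_, ?_⟩
  · rw [mem_interval]
    have : (2 * r + 1) / 2 = r := by omega
    rw [this]
    constructor
    · by_contra hc
      have : q + r + 1 ≤ 0 := by omega
      nlinarith
    · by_contra hc
      have : 0 ≤ q - r - 1 := by omega
      nlinarith
  · rw [mem_interval]
    omega
  · push_cast
    linarith

theorem PerfectOrder.mul {g m : ℕ} (hgo : Odd g) (hmo : Odd m)
    (hg : PerfectOrder g) (hm : PerfectOrder m) :
    PerfectOrder (g * m) := by
  refine Realizes.inflate hgo hm hg ?_ ?_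
  · obtain ⟨h, rfl⟩ := hgo
    obtain ⟨r, rfl⟩ := hmo
    exact fun t ht => exists_quotient r h ht
  · rw [card_interval hmo, card_interval (hgo.mul hmo), mul_comm]

theorem interval_subset {g n : ℕ} (h : g ≤ n) : interval g ⊆ interval n := by
  intro d
  simp only [mem_interval]
  have := Nat.div_le_div_right (c := 2) h
  omega

theorem PointedOrder.inflate {g m : ℕ} (hgo : Odd g) (hmo : Odd m)
    (hg : PerfectOrder g) (hm : PointedOrder m) :
    Realizes (interval (g * m) \ interval g).val := by
  refine Realizes.inflate hgo hm hg ?_ ?_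
  · obtain ⟨h, rfl⟩ := hgo
    obtain ⟨r, rfl⟩ := hmo
    intro t ht
    rw [Finset.mem_sdiff] at ht
    obtain ⟨q, hq, b, hb, rfl⟩ := exists_quotient r h ht.1
    refine ⟨q, Finset.mem_erase.2 ⟨?_, hq⟩, b, hb, rfl⟩
    rintro rfl
    -- Quotient zero means lying in the hole `interval g`.
    exact ht.2 (by simpa using hb)
  · rw [Finset.card_erase_of_mem (zero_mem_interval m),
      Finset.card_sdiff_of_subset (interval_subset (Nat.le_mul_of_pos_right g hmo.pos)),
      card_interval hmo, card_interval hgo, card_interval (hgo.mul hmo), Nat.sub_mul, one_mul,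
      mul_comm]

/-! ### Symmetric sets of differences -/

/-- The values `±n` for `n` in the list. -/
def sym (l : List ℕ) : Multiset ℤ :=
  (l.map fun n : ℕ => (n : ℤ) : List ℤ) + (l.map fun n : ℕ => -(n : ℤ) : List ℤ)

theorem mem_sym {l : List ℕ} {d : ℤ} : d ∈ sym l ↔ d.natAbs ∈ l := by
  simp only [sym, Multiset.mem_add, Multiset.mem_coe, List.mem_map]
  constructor
  · rintro (⟨n, hn, rfl⟩ | ⟨n, hn, rfl⟩) <;> simpa using hn
  · intro h
    rcases Int.natAbs_eq d with h' | h'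
    · exact Or.inl ⟨_, h, h'.symm⟩
    · exact Or.inr ⟨_, h, h'.symm⟩

theorem card_sym (l : List ℕ) : Multiset.card (sym l) = 2 * l.length := by
  simp [sym]; ring

theorem sym_append (l l' : List ℕ) : sym (l ++ l') = sym l + sym l' := by
  simp only [sym, List.map_append, ← Multiset.coe_add]
  abel

theorem sym_perm {l l' : List ℕ} (h : l.Perm l') : sym l = sym l' := by
  simp only [sym]
  rw [Multiset.coe_eq_coe.2 (h.map _), Multiset.coe_eq_coe.2 (h.map fun n : ℕ => -(n : ℤ))]

theorem sym_smul (k : ℕ) (l : List ℕ) :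
    (sym l).map (fun a => (k : ℤ) * a) = sym (l.map fun n => k * n) := by
  simp [sym, Function.comp_def]

theorem sym_range' (m : ℕ) (hm : Odd m) :
    sym (List.range' 1 (m / 2)) = ((interval m).erase 0).val := by
  refine Finset.val_eq_of_card_le (fun t ht => ?_) ?_
  · rw [Finset.mem_erase, mem_interval] at ht
    rw [mem_sym, List.mem_range'_1]
    omega
  · rw [card_sym, List.length_range', Finset.card_erase_of_mem (zero_mem_interval m),
      card_interval hm]
    obtain ⟨r, rfl⟩ := hm
    omega

/-- The positive differences to be realized when an order is inflated by `g` about its zero column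
and then extended by `2 * s`; here `L` is half of the inflated order. -/
def extension (g s L : ℕ) : List ℕ :=
  List.range' 1 (g / 2) ++ List.range' (L + 1) s

/-- The hole, the inflated part and the new outer values tile the nonzero part of the larger
interval. -/
theorem sym_extension_add {g m : ℕ} (hgo : Odd g) (hmo : Odd m) (s : ℕ) :
    sym (extension g s (g * m / 2)) + (interval (g * m) \ interval g).val =
      ((interval (g * m + 2 * s)).erase 0).val := by
  have hle : g ≤ g * m := Nat.le_mul_of_pos_right g hmo.pos
  have hodd : Odd (g * m) := hgo.mul hmo
  have hodd' : Odd (g * m + 2 * s) := hodd.add_even (even_two_mul s)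
  refine Finset.val_eq_of_card_le (fun t ht => ?_) ?_
  · rw [Finset.mem_erase, mem_interval] at ht
    rw [Multiset.mem_add, mem_sym, Finset.mem_val, Finset.mem_sdiff, mem_interval, mem_interval,
      extension, List.mem_append, List.mem_range'_1, List.mem_range'_1]
    omega
  · rw [Multiset.card_add, card_sym, extension, List.length_append, List.length_range',
      List.length_range', Finset.card_val,
      Finset.card_sdiff_of_subset (interval_subset hle), card_interval hodd, card_interval hgo,
      Finset.card_erase_of_mem (zero_mem_interval _), card_interval hodd']
    obtain ⟨h, rfl⟩ := hgo
    omega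

theorem PointedOrder.extend {g m s : ℕ} (hgo : Odd g) (hmo : Odd m)
    (hg : PerfectOrder g) (hm : PointedOrder m)
    (he : Realizes (sym (extension g s (g * m / 2)))) : PointedOrder (g * m + 2 * s) := by
  have := he.add (hm.inflate hgo hmo hg)
  rwa [sym_extension_add hgo hmo] at this

theorem PerfectOrder.extend {g m s : ℕ} (hgo : Odd g) (hmo : Odd m)
    (hg : PerfectOrder g) (hm : PointedOrder m)
    (he : Realizes (0 ::ₘ sym (extension g s (g * m / 2)))) : PerfectOrder (g * m + 2 * s) := by
  have := he.add (hm.inflate hgo hmo hg)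
  rwa [Multiset.cons_add, sym_extension_add hgo hmo,
    ← Finset.insert_val_of_notMem (Finset.notMem_erase _ _),
    Finset.insert_erase (zero_mem_interval _)] at this

/-! ### Blocks -/

/-- The differences of ordered pairs of distinct points of a block. -/
def pairDiffs {k : ℕ} (p : Fin k → ℤ) : Multiset ℤ :=
  (Finset.univ : Finset (Fin k)).offDiag.val.map fun q => p q.2 - p q.1

/-- A family of quadruples in which each two of the four places run through all ordered pairs of
distinct points turns the differences of a block into columns. -/
theorem realizes_pairDiffs {k : ℕ} (T : Multiset (Fin 4 → Fin k))
    (hT : ∀ i j, i < j → T.map (fun t => (t i, t j)) = (Finset.univ : Finset (Fin k)).offDiag.val)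
    (p : Fin k → ℤ) : Realizes (pairDiffs p) := by
  -- Each quadruple of block points is translated so that its first point becomes the origin; the
  -- six edges are then the differences of its places.
  refine ⟨T.map fun t => (p (t 1) - p (t 0), p (t 2) - p (t 0), p (t 3) - p (t 0)), fun i => ?_⟩
  have key : ∀ a b, a < b → T.map (fun t => p (t b) - p (t a)) = pairDiffs p := fun a b hab => by
    rw [pairDiffs, ← hT a b hab, Multiset.map_map]
    rfl
  rw [Multiset.map_map]
  fin_cases i
  · exact key 0 1 (by decide)
  · exact key 0 2 (by decide)
  · exact key 0 3 (by decide)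
  · simpa [edges, Function.comp_def] using key 1 2 (by decide)
  · simpa [edges, Function.comp_def] using key 1 3 (by decide)
  · simpa [edges, Function.comp_def] using key 2 3 (by decide)

/-- The even permutations of four points are sharply doubly transitive. -/
theorem realizes_pairDiffs_four (p : Fin 4 → ℤ) : Realizes (pairDiffs p) :=
  realizes_pairDiffs ((Finset.univ.filter fun σ : Equiv.Perm (Fin 4) => σ.sign = 1).val.map
    fun σ : Equiv.Perm (Fin 4) => (σ : Fin 4 → Fin 4)) (by decide +kernel) p

/-- The affine maps of the field with five elements are sharply doubly transitive. -/
theorem realizes_pairDiffs_five (p : Fin 5 → ℤ) : Realizes (pairDiffs p) :=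
  realizes_pairDiffs ((Finset.univ.filter fun ab : Fin 5 × Fin 5 => ab.1 ≠ 0).val.map
    -- Only four of the five field elements serve as places; two distinct places still determine the
    -- affine map.
    fun ab j => ab.1 * j.castSucc + ab.2) (by decide +kernel) p

/-- The positive differences of the block with consecutive gaps `x`, `y`, `z`. -/
def fourDiffs : ℕ × ℕ × ℕ → List ℕ
  | (x, y, z) => [x, y, z, x + y, y + z, x + y + z]

/-- The positive differences of the block with consecutive gaps `x`, `y`, `z`, `w`. -/
def fiveDiffs : ℕ × ℕ × ℕ × ℕ → List ℕ
  | (x, y, z, w) =>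
    [x, y, z, w, x + y, y + z, z + w, x + y + z, y + z + w, x + y + z + w]

theorem realizes_fourDiffs (b : ℕ × ℕ × ℕ) : Realizes (sym (fourDiffs b)) := by
  obtain ⟨x, y, z⟩ := b
  -- The pairs are listed in the order of `fourDiffs`, first increasing and then reversed, so that
  -- both sides agree as lists up to arithmetic.
  have h : ((Finset.univ : Finset (Fin 4)).offDiag.val : Multiset (Fin 4 × Fin 4)) =
      ([(0, 1), (1, 2), (2, 3), (0, 2), (1, 3), (0, 3), (1, 0), (2, 1), (3, 2), (2, 0), (3, 1),
        (3, 0)] : List (Fin 4 × Fin 4)) := by decide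
  have := realizes_pairDiffs_four ![0, (x : ℤ), x + y, x + y + z]
  rw [pairDiffs, h] at this
  convert this using 1
  simp only [sym, fourDiffs, Multiset.map_coe, Multiset.coe_add]
  congr 1
  simp
  ring_nf
  simp

theorem realizes_fiveDiffs (b : ℕ × ℕ × ℕ × ℕ) : Realizes (sym (fiveDiffs b)) := by
  obtain ⟨x, y, z, w⟩ := b
  have h : ((Finset.univ : Finset (Fin 5)).offDiag.val : Multiset (Fin 5 × Fin 5)) =
      ([(0, 1), (1, 2), (2, 3), (3, 4), (0, 2), (1, 3), (2, 4), (0, 3), (1, 4), (0, 4),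
        (1, 0), (2, 1), (3, 2), (4, 3), (2, 0), (3, 1), (4, 2), (3, 0), (4, 1), (4, 0)] :
          List (Fin 5 × Fin 5)) := by
    decide
  have := realizes_pairDiffs_five ![0, (x : ℤ), x + y, x + y + z, x + y + z + w]
  rw [pairDiffs, h] at this
  convert this using 1
  simp only [sym, fiveDiffs, Multiset.map_coe, Multiset.coe_add]
  congr 1
  simp
  ring_nf
  simp

/-! ### Checking that a list enumerates given values -/

/-- The set of the elements of a list, as a bit mask. -/
def mask (l : List ℕ) : ℕ :=
  l.foldl (fun m x => m ||| 1 <<< x) 0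

theorem testBit_or_one_shiftLeft (m x j : ℕ) :
    (m ||| 1 <<< x).testBit j = true ↔ m.testBit j = true ∨ j = x := by
  rw [Nat.testBit_or, Nat.one_shiftLeft, Nat.testBit_two_pow, Bool.or_eq_true,
    decide_eq_true_iff, eq_comm (a := x)]

theorem testBit_mask (l : List ℕ) (j : ℕ) : (mask l).testBit j = true ↔ j ∈ l := by
  have key : ∀ (l : List ℕ) (m : ℕ),
      (l.foldl (fun m x => m ||| 1 <<< x) m).testBit j = true ↔ m.testBit j = true ∨ j ∈ l := by
    intro l
    induction l with
    | nil => simp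
    | cons x l ih =>
      intro m
      rw [List.foldl_cons, ih, testBit_or_one_shiftLeft, List.mem_cons, or_assoc]
  simpa [mask] using key l 0

/-- The two lists have the same length and the same elements. -/
def sameValues (l T : List ℕ) : Bool :=
  l.length == T.length && mask l == mask T

/-- Equal masks make every element of `T` occur in `l`; as `T` has no repetitions, equal lengths
then exclude repetitions in `l`. -/
theorem perm_of_sameValues {l T : List ℕ} (hT : T.Nodup) (h : sameValues l T = true) :
    l.Perm T := by
  simp only [sameValues, Bool.and_eq_true, beq_iff_eq] at h
  refine ((List.subperm_of_subset hT fun j hj => ?_).perm_of_length_le h.1.le).symm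
  rwa [← testBit_mask, h.2, testBit_mask]

theorem nodup_extension {g s L : ℕ} (h : g / 2 ≤ L) : (extension g s L).Nodup := by
  refine List.Nodup.append List.nodup_range' List.nodup_range' fun j hj hj' => ?_
  rw [List.mem_range'_1] at hj hj'
  omega

/-! ### Realizing symmetric sets by blocks and smaller orders -/

theorem realizes_sym_flatMap {α : Type*} (f : α → List ℕ) (l : List α)
    (h : ∀ a ∈ l, Realizes (sym (f a))) : Realizes (sym (l.flatMap f)) := by
  induction l with
  | nil => exact Realizes.zero
  | cons a l ih =>
    rw [List.flatMap_cons, sym_append]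
    exact (h a List.mem_cons_self).add (ih fun b hb => h b (List.mem_cons_of_mem _ hb))

/-- The positive differences of a list of blocks with five and four points. -/
def blockValues (fives : List (ℕ × ℕ × ℕ × ℕ)) (fours : List (ℕ × ℕ × ℕ)) : List ℕ :=
  fives.flatMap fiveDiffs ++ fours.flatMap fourDiffs

theorem realizes_blockValues (fives : List (ℕ × ℕ × ℕ × ℕ)) (fours : List (ℕ × ℕ × ℕ)) :
    Realizes (sym (blockValues fives fours)) := by
  rw [blockValues, sym_append]
  exact (realizes_sym_flatMap _ _ fun b _ => realizes_fiveDiffs b).add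
    (realizes_sym_flatMap _ _ fun b _ => realizes_fourDiffs b)

/-- The positive elements of `k` times `interval h`. -/
def coreValues (c : ℕ × ℕ) : List ℕ :=
  (List.range' 1 (c.1 / 2)).map fun n => c.2 * n

theorem realizes_coreValues {c : ℕ × ℕ} (ho : Odd c.1) (h : PointedOrder c.1) :
    Realizes (sym (coreValues c)) := by
  rw [coreValues, ← sym_smul, sym_range' _ ho]
  exact Realizes.smul _ h

theorem realizes_zero_cons_coreValues {c : ℕ × ℕ} (ho : Odd c.1) (h : PerfectOrder c.1) :
    Realizes (0 ::ₘ sym (coreValues c)) := by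
  have := Realizes.smul c.2 h
  rwa [← Finset.insert_erase (zero_mem_interval c.1),
    Finset.insert_val_of_notMem (Finset.notMem_erase _ _), Multiset.map_cons, mul_zero,
    ← sym_range' _ ho, sym_smul] at this

/-! ### Realizing sets by an explicit list of columns -/

/-- An injection of the integers into the natural numbers. -/
def intKey (d : ℤ) : ℕ :=
  if d < 0 then 2 * d.natAbs + 1 else 2 * d.natAbs

theorem intKey_injective : Function.Injective intKey := by
  intro a b h
  simp only [intKey] at h
  split_ifs at h <;> omega

/-- All six difference maps run through `T` on the given columns. -/
def solvesList (K : List (ℤ × ℤ × ℤ)) (T : List ℤ) : Bool :=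
  let t := T.map intKey
  [K.map fun c => c.1, K.map fun c => c.2.1, K.map fun c => c.2.2, K.map fun c => c.2.1 - c.1,
    K.map fun c => c.2.2 - c.1, K.map fun c => c.2.2 - c.2.1].all
    fun l => sameValues (l.map intKey) t

theorem realizes_of_solvesList {K : List (ℤ × ℤ × ℤ)} {T : List ℤ} (hT : T.Nodup)
    (h : solvesList K T = true) : Realizes T := by
  have key : ∀ l : List ℤ, sameValues (l.map intKey) (T.map intKey) = true →
      (l : Multiset ℤ) = T := fun l hl =>
    Multiset.coe_eq_coe.2 ((List.map_perm_map_iff intKey_injective).1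
      (perm_of_sameValues ((List.nodup_map_iff intKey_injective).2 hT) hl))
  simp only [solvesList, List.all_cons, List.all_nil, Bool.and_true, Bool.and_eq_true] at h
  obtain ⟨h0, h1, h2, h3, h4, h5⟩ := h
  refine ⟨K, fun i => ?_⟩
  rw [Multiset.map_coe]
  fin_cases i
  exacts [key _ h0, key _ h1, key _ h2, key _ h3, key _ h4, key _ h5]

/-- The values `±n` for `n` in the list. -/
def symList (l : List ℕ) : List ℤ :=
  (l.map fun n : ℕ => (n : ℤ)) ++ l.map fun n : ℕ => -(n : ℤ)

theorem coe_symList (l : List ℕ) : (symList l : Multiset ℤ) = sym l := by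
  rw [symList, ← Multiset.coe_add, sym]

theorem nodup_symList {l : List ℕ} (hl : l.Nodup) (h0 : 0 ∉ l) : (symList l).Nodup := by
  refine List.Nodup.append (hl.map Nat.cast_injective)
    (hl.map (neg_injective.comp Nat.cast_injective)) fun d hd hd' => ?_
  obtain ⟨a, ha, rfl⟩ := List.mem_map.1 hd
  obtain ⟨b, hb, hab⟩ := List.mem_map.1 hd'
  obtain rfl : a = 0 := by omega
  exact h0 ha

/-- The columns realize `±T`, or `±T` and zero if their number is odd. -/
def solvesSym (K : List (ℤ × ℤ × ℤ)) (T : List ℕ) : Bool :=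
  solvesList K (if K.length % 2 = 0 then symList T else 0 :: symList T)

theorem realizes_of_solvesSym {K : List (ℤ × ℤ × ℤ)} {T : List ℕ} (hT : T.Nodup) (h0 : 0 ∉ T)
    (h : solvesSym K T = true) :
    if K.length % 2 = 0 then Realizes (sym T) else Realizes (0 ::ₘ sym T) := by
  have hnd := nodup_symList hT h0
  unfold solvesSym at h
  split_ifs with hK
  · rw [if_pos hK] at h
    rw [← coe_symList]
    exact realizes_of_solvesList hnd h
  · rw [if_neg hK] at h
    rw [← coe_symList]
    refine realizes_of_solvesList (List.nodup_cons.2 ⟨?_, hnd⟩) h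
    rwa [← Multiset.mem_coe, coe_symList, mem_sym]

/-! ### Sets of orders known to be perfect or pointed -/

/-- Bit masks of orders. -/
structure KnownOrders where
  perfect : ℕ
  pointed : ℕ

namespace KnownOrders

/-- The orders in the two sets are odd and have the property indicated. -/
structure Sound (k : KnownOrders) : Prop where
  perfect : ∀ n, k.perfect.testBit n = true → Odd n ∧ PerfectOrder n
  pointed : ∀ n, k.pointed.testBit n = true → Odd n ∧ PointedOrder n

def addPerfect (k : KnownOrders) (n : ℕ) : KnownOrders :=
  ⟨k.perfect ||| 1 <<< n, k.pointed⟩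

/-- Both masks change because a pointed order is perfect. -/
def addPointed (k : KnownOrders) (n : ℕ) : KnownOrders :=
  ⟨k.perfect ||| 1 <<< n, k.pointed ||| 1 <<< n⟩

theorem Sound.addPerfect {k : KnownOrders} (hk : k.Sound) {n : ℕ} (ho : Odd n)
    (hn : PerfectOrder n) : (k.addPerfect n).Sound := by
  refine ⟨fun j hj => ?_, hk.pointed⟩
  rcases (testBit_or_one_shiftLeft _ _ _).1 hj with hj | rfl
  exacts [hk.perfect j hj, ⟨ho, hn⟩]

theorem Sound.addPointed {k : KnownOrders} (hk : k.Sound) {n : ℕ} (ho : Odd n)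
    (hn : PointedOrder n) : (k.addPointed n).Sound := by
  refine ⟨(hk.addPerfect ho hn.perfect).perfect, fun j hj => ?_⟩
  rcases (testBit_or_one_shiftLeft _ _ _).1 hj with hj | rfl
  exacts [hk.pointed j hj, ⟨ho, hn⟩]

/-- The cores are orders known to be pointed, except that the first may be merely perfect. -/
def coresPerfect (k : KnownOrders) : List (ℕ × ℕ) → Bool
  | [] => false
  | c :: cores => k.perfect.testBit c.1 && cores.all fun c => k.pointed.testBit c.1

theorem Sound.realizes_cores {k : KnownOrders} (hk : k.Sound) {cores : List (ℕ × ℕ)}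
    (h : (cores.all fun c => k.pointed.testBit c.1) = true) :
    Realizes (sym (cores.flatMap coreValues)) := by
  refine realizes_sym_flatMap _ _ fun c hc => ?_
  obtain ⟨ho, hp⟩ := hk.pointed _ (List.all_eq_true.1 h c hc)
  exact realizes_coreValues ho hp

/-- The value zero must be produced exactly once, so one core contributes it with its nonzero
values, and all others must do without. -/
theorem Sound.realizes_zero_cons_cores {k : KnownOrders} (hk : k.Sound) {cores : List (ℕ × ℕ)}
    (h : k.coresPerfect cores = true) :
    Realizes (0 ::ₘ sym (cores.flatMap coreValues)) := by
  cases cores with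
  | nil => simp [coresPerfect] at h
  | cons c cores =>
    rw [coresPerfect, Bool.and_eq_true] at h
    obtain ⟨ho, hp⟩ := hk.perfect _ h.1
    rw [List.flatMap_cons, sym_append, ← Multiset.cons_add]
    exact (realizes_zero_cons_coreValues ho hp).add (hk.realizes_cores h.2)

end KnownOrders

/-- Cores and blocks, the latter given by their gaps. -/
structure Design where
  cores : List (ℕ × ℕ)
  fives : List (ℕ × ℕ × ℕ × ℕ)
  fours : List (ℕ × ℕ × ℕ)

namespace Design

def values (d : Design) : List ℕ :=
  d.cores.flatMap coreValues ++ blockValues d.fives d.fours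

theorem realizes {k : KnownOrders} (hk : k.Sound) (d : Design) {T : List ℕ}
    (hT : d.values.Perm T) (h : (d.cores.all fun c => k.pointed.testBit c.1) = true) :
    Realizes (sym T) := by
  rw [← sym_perm hT, values, sym_append]
  exact (hk.realizes_cores h).add (realizes_blockValues _ _)

theorem realizes_zero_cons {k : KnownOrders} (hk : k.Sound) (d : Design) {T : List ℕ}
    (hT : d.values.Perm T) (h : k.coresPerfect d.cores = true) :
    Realizes (0 ::ₘ sym T) := by
  rw [← sym_perm hT, values, sym_append, ← Multiset.cons_add]
  exact (hk.realizes_zero_cons_cores h).add (realizes_blockValues _ _)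

end Design

/-- Numbers below `1000` stand for themselves, while `1000 + e` stands for `L + e`. -/
def shift (L c : ℕ) : ℕ :=
  if c < 1000 then c else L + (c - 1000)

/-- The values that the integers `±c` stand for when `c` stands for `shift L c`. -/
def shiftInt (L : ℕ) (c : ℤ) : ℤ :=
  if c < 0 then -(shift L c.natAbs : ℤ) else shift L c.natAbs

def Design.shift (L : ℕ) (d : Design) : Design where
  cores := d.cores
  fives := d.fives.map fun (x, y, z, w) =>
    (_root_.shift L x, _root_.shift L y, _root_.shift L z, _root_.shift L w)
  fours := d.fours.map fun (x, y, z) => (_root_.shift L x, _root_.shift L y, _root_.shift L z)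

/-! ### Sound rules for adding an order -/

namespace KnownOrders

theorem sym_range'_cons (m : ℕ) (hm : Odd m) :
    0 ::ₘ sym (List.range' 1 (m / 2)) = (interval m).val := by
  rw [sym_range' m hm, ← Finset.insert_val_of_notMem (Finset.notMem_erase _ _),
    Finset.insert_erase (zero_mem_interval _)]

/-- Add the order `m` if the given columns prove it perfect or pointed. -/
def addColumns (k : KnownOrders) (e : ℕ × List (ℤ × ℤ × ℤ)) : KnownOrders :=
  if e.1 % 2 = 1 ∧ solvesSym e.2 (List.range' 1 (e.1 / 2)) = true then
    if e.2.length % 2 = 0 then k.addPointed e.1 else k.addPerfect e.1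
  else k

theorem Sound.addColumns {k : KnownOrders} (hk : k.Sound) (e : ℕ × List (ℤ × ℤ × ℤ)) :
    (k.addColumns e).Sound := by
  unfold KnownOrders.addColumns
  split_ifs with h hK
  · have ho := Nat.odd_iff.2 h.1
    have := realizes_of_solvesSym List.nodup_range' (by simp) h.2
    rw [if_pos hK, sym_range' _ ho] at this
    exact hk.addPointed ho this
  · have ho := Nat.odd_iff.2 h.1
    have := realizes_of_solvesSym List.nodup_range' (by simp) h.2
    rw [if_neg hK, sym_range'_cons _ ho] at this
    exact hk.addPerfect ho this
  · exact hk

/-- Add the order `m` if the given design proves it perfect or pointed. -/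
def addDesign (k : KnownOrders) (e : ℕ × Design) : KnownOrders :=
  if e.1 % 2 = 1 ∧ sameValues e.2.values (List.range' 1 (e.1 / 2)) = true then
    if (e.2.cores.all fun c => k.pointed.testBit c.1) = true then k.addPointed e.1
    else if k.coresPerfect e.2.cores = true then k.addPerfect e.1
    else k
  else k

theorem Sound.addDesign {k : KnownOrders} (hk : k.Sound) (e : ℕ × Design) :
    (k.addDesign e).Sound := by
  unfold KnownOrders.addDesign
  split_ifs with h hc hc'
  · have ho := Nat.odd_iff.2 h.1
    have := e.2.realizes hk (perm_of_sameValues List.nodup_range' h.2) hc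
    rw [sym_range' _ ho] at this
    exact hk.addPointed ho this
  · have ho := Nat.odd_iff.2 h.1
    have := e.2.realizes_zero_cons hk (perm_of_sameValues List.nodup_range' h.2) hc'
    rw [sym_range'_cons _ ho] at this
    exact hk.addPerfect ho this
  · exact hk
  · exact hk

/-- Add the order `m` if it is the product of `a` and another perfect order. -/
def addProduct (m : ℕ) (k : KnownOrders) (a : ℕ) : KnownOrders :=
  if m % a = 0 ∧ k.perfect.testBit a = true ∧ k.perfect.testBit (m / a) = true then k.addPerfect m
  else k

theorem Sound.addProduct {k : KnownOrders} (hk : k.Sound) (m a : ℕ) :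
    (addProduct m k a).Sound := by
  unfold KnownOrders.addProduct
  split_ifs with h
  · obtain ⟨hm, ha, hb⟩ := h
    have hma : a * (m / a) = m := Nat.mul_div_cancel' (Nat.dvd_of_mod_eq_zero hm)
    obtain ⟨hao, ha⟩ := hk.perfect _ ha
    obtain ⟨hbo, hb⟩ := hk.perfect _ hb
    rw [← hma]
    exact hk.addPerfect (hao.mul hbo) (ha.mul hao hbo hb)
  · exact hk

/-- The order `m` is `g * n + 2 * s` for a perfect order `g` and a pointed order `n`. -/
def Extends (k : KnownOrders) (m g s : ℕ) : Prop :=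
  2 * s ≤ m ∧ (m - 2 * s) % g = 0 ∧ k.pointed.testBit ((m - 2 * s) / g) = true ∧
    k.perfect.testBit g = true

instance (k : KnownOrders) (m g s : ℕ) : Decidable (k.Extends m g s) :=
  inferInstanceAs (Decidable (_ ∧ _))

theorem Sound.exists_of_extends {k : KnownOrders} (hk : k.Sound) {m g s : ℕ}
    (h : k.Extends m g s) : ∃ n, m - 2 * s = g * n ∧ m = g * n + 2 * s ∧ Odd m ∧ Odd g ∧ Odd n ∧
      PerfectOrder g ∧ PointedOrder n ∧ g / 2 ≤ g * n / 2 := by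
  obtain ⟨hs, hm, hn, hg⟩ := h
  obtain ⟨hgo, hg⟩ := hk.perfect _ hg
  obtain ⟨hno, hn⟩ := hk.pointed _ hn
  have hma : m - 2 * s = g * ((m - 2 * s) / g) :=
    (Nat.mul_div_cancel' (Nat.dvd_of_mod_eq_zero hm)).symm
  have hm' : m = g * ((m - 2 * s) / g) + 2 * s := by omega
  refine ⟨_, hma, hm', ?_, hgo, hno, hg, hn,
    Nat.div_le_div_right (Nat.le_mul_of_pos_right g hno.pos)⟩
  rw [hm']
  exact (hgo.mul hno).add_even (even_two_mul s)

/-- Add the order `m` if the given extension applies to it. -/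
def addExtension (m : ℕ) (k : KnownOrders) (e : ℕ × ℕ × Design) : KnownOrders :=
  if k.Extends m e.1 e.2.1 ∧ sameValues (e.2.2.shift ((m - 2 * e.2.1) / 2)).values
      (extension e.1 e.2.1 ((m - 2 * e.2.1) / 2)) = true then
    if (e.2.2.cores.all fun c => k.pointed.testBit c.1) = true then k.addPointed m
    else if k.coresPerfect e.2.2.cores = true then k.addPerfect m
    else k
  else k

theorem Sound.addExtension {k : KnownOrders} (hk : k.Sound) (m : ℕ) (e : ℕ × ℕ × Design) :
    (addExtension m k e).Sound := by
  obtain ⟨g, s, d⟩ := e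
  unfold KnownOrders.addExtension
  split_ifs with h hc hc'
  · obtain ⟨n, hn, rfl, hmo, hgo, hno, hg, hnp, hle⟩ := hk.exists_of_extends h.1
    have h2 := h.2
    simp only [Nat.add_sub_cancel] at h2
    exact hk.addPointed hmo (hnp.extend hgo hno hg
      ((d.shift _).realizes hk (perm_of_sameValues (nodup_extension hle) h2) hc))
  · obtain ⟨n, hn, rfl, hmo, hgo, hno, hg, hnp, hle⟩ := hk.exists_of_extends h.1
    have h2 := h.2
    simp only [Nat.add_sub_cancel] at h2
    exact hk.addPerfect hmo (hg.extend hgo hno hnp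
      ((d.shift _).realizes_zero_cons hk (perm_of_sameValues (nodup_extension hle) h2) hc'))
  · exact hk
  · exact hk

/-- Add the order `m` if the extension with the given columns applies to it. -/
def addColumnExtension (m : ℕ) (k : KnownOrders) (e : ℕ × ℕ × List (ℤ × ℤ × ℤ)) : KnownOrders :=
  if k.Extends m e.1 e.2.1 ∧ solvesSym (e.2.2.map fun c =>
        (shiftInt ((m - 2 * e.2.1) / 2) c.1, shiftInt ((m - 2 * e.2.1) / 2) c.2.1,
          shiftInt ((m - 2 * e.2.1) / 2) c.2.2))
      (extension e.1 e.2.1 ((m - 2 * e.2.1) / 2)) = true then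
    if e.2.2.length % 2 = 0 then k.addPointed m else k.addPerfect m
  else k

theorem Sound.addColumnExtension {k : KnownOrders} (hk : k.Sound) (m : ℕ)
    (e : ℕ × ℕ × List (ℤ × ℤ × ℤ)) : (addColumnExtension m k e).Sound := by
  obtain ⟨g, s, K⟩ := e
  unfold KnownOrders.addColumnExtension
  have h0 : ∀ L, 0 ∉ extension g s L := fun L h => by
    rw [extension, List.mem_append, List.mem_range'_1, List.mem_range'_1] at h
    omega
  split_ifs with h hc
  · obtain ⟨n, hn, rfl, hmo, hgo, hno, hg, hnp, hle⟩ := hk.exists_of_extends h.1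
    have h2 := realizes_of_solvesSym (nodup_extension (by simpa using hle)) (h0 _) h.2
    rw [List.length_map, if_pos hc] at h2
    simp only [Nat.add_sub_cancel] at h2
    exact hk.addPointed hmo (hnp.extend hgo hno hg h2)
  · obtain ⟨n, hn, rfl, hmo, hgo, hno, hg, hnp, hle⟩ := hk.exists_of_extends h.1
    have h2 := realizes_of_solvesSym (nodup_extension (by simpa using hle)) (h0 _) h.2
    rw [List.length_map, if_neg hc] at h2
    simp only [Nat.add_sub_cancel] at h2
    exact hk.addPerfect hmo (hg.extend hgo hno hnp h2)
  · exact hk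

theorem Sound.foldl {α : Type*} {f : KnownOrders → α → KnownOrders}
    (hf : ∀ k a, k.Sound → (f k a).Sound) (l : List α) {k : KnownOrders} (hk : k.Sound) :
    (l.foldl f k).Sound := by
  induction l generalizing k with
  | nil => exact hk
  | cons a l ih => exact ih (hf k a hk)

/-- The mask `2` has only bit `1` set and stands for order `1`. -/
theorem sound_one : (⟨2, 2⟩ : KnownOrders).Sound := by
  have h : ∀ n, (2 : ℕ).testBit n = true → n = 1 := fun n hn => by
    rw [show (2 : ℕ) = 2 ^ 1 by rfl, Nat.testBit_two_pow] at hn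
    exact (of_decide_eq_true hn).symm
  constructor <;> intro n hn <;> obtain rfl := h n hn
  exacts [⟨odd_one, pointed_one.perfect⟩, ⟨odd_one, pointed_one⟩]

end KnownOrders

/-! ### Exhaustive search for exact covers

The search runs in the kernel, so it is written with recursors and the primitive operations on
natural numbers. Sets of positions are bit masks. -/

/-- The elements of `l` disjoint from `m`. -/
def keepDisjoint (m : ℕ) (l : List ℕ) : List ℕ :=
  List.rec [] (fun a _ ih => Bool.rec ih (a :: ih) (Nat.beq (Nat.land a m) 0)) l

/-- The elements of `l` that do not occur in `l'`. -/
def dropElements (l' l : List ℕ) : List ℕ :=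
  List.rec [] (fun a _ ih => Bool.rec (a :: ih) ih
    (List.rec (motive := fun _ => Bool) false (fun b _ ih' => Bool.rec ih' true (Nat.beq a b)) l'))
    l

/-- All elements of `l` that meet `b` satisfy `f`. -/
def allMeeting (b : ℕ) (f : ℕ → Bool) (l : List ℕ) : Bool :=
  List.rec true (fun a _ ih => Bool.rec (Bool.rec false ih (f a)) ih (Nat.beq (Nat.land a b) 0)) l

/-- True if `l`, together with `t₁`, does not cover `rem`, and otherwise the value of `cont` on the
positions that are covered once, on those that are covered twice, or on `rem`, whichever set is the
first not to be empty. -/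
def coverageThen (rem : ℕ) (cont : ℕ → Bool) (l : List ℕ) : ℕ → ℕ → ℕ → Bool :=
  List.rec (motive := fun _ => ℕ → ℕ → ℕ → Bool)
    -- The accumulators hold the positions covered at least once, twice and three times, so `xor` of
    -- neighbours gives those covered exactly once or twice.
    (fun t₁ t₂ t₃ => Bool.rec true
      (Bool.rec (cont (Nat.xor t₁ t₂)) (Bool.rec (cont (Nat.xor t₂ t₃)) (cont rem)
        (Nat.beq t₂ t₃)) (Nat.beq t₁ t₂)) (Nat.beq (Nat.land t₁ rem) rem))
    (fun a _ ih t₁ t₂ t₃ => ih (Nat.lor t₁ a) (Nat.lor t₂ (Nat.land t₁ a))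
      (Nat.lor t₃ (Nat.land t₂ a))) l

/-- True only if `rem` is not the disjoint union of elements of the list. -/
def refutes (n : ℕ) : ℕ → List ℕ → Bool :=
  Nat.rec (motive := fun _ => ℕ → List ℕ → Bool) (fun _ _ => false)
    (fun _ ih rem cands => coverageThen rem (fun ch =>
      -- Here `b` is the lowest set bit of `ch`, a position with few candidates where possible.
      -- Soundness needs only that `b` meets `rem`, and this is tested.
      (fun b => Bool.rec (allMeeting b (fun m => ih (Nat.xor rem m) (keepDisjoint m cands)) cands)
        false (Nat.beq (Nat.land b rem) 0)) (Nat.xor ch (Nat.land ch (Nat.sub ch 1)))) cands 0 0 0)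
    n

theorem mem_keepDisjoint {m a : ℕ} {l : List ℕ} (ha : a ∈ l) (hd : a &&& m = 0) :
    a ∈ keepDisjoint m l := by
  induction l with
  | nil => simp at ha
  | cons b l ih =>
    have e : keepDisjoint m (b :: l) =
        Bool.rec (keepDisjoint m l) (b :: keepDisjoint m l) (Nat.beq (b &&& m) 0) := rfl
    rw [e]
    cases hb : Nat.beq (b &&& m) 0
    · rcases List.mem_cons.1 ha with rfl | ha
      · rw [hd] at hb
        exact absurd hb (by decide)
      · exact ih ha
    · rcases List.mem_cons.1 ha with rfl | ha
      · exact List.mem_cons_self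
      · exact List.mem_cons_of_mem _ (ih ha)

theorem mem_dropElements {a : ℕ} {l l' : List ℕ} (ha : a ∈ l) (hd : a ∉ l') :
    a ∈ dropElements l' l := by
  have elem : ∀ (l' : List ℕ), a ∉ l' → (List.rec (motive := fun _ => Bool) false
      (fun b _ ih' => Bool.rec ih' true (Nat.beq a b)) l' : Bool) = false := by
    intro l'
    induction l' with
    | nil => intro _; rfl
    | cons b l' ih =>
      intro h
      rw [List.mem_cons, not_or] at h
      have hb : Nat.beq a b = false := by
        rw [← Bool.not_eq_true, Nat.beq_eq]
        exact h.1
      simp only [hb]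
      exact ih h.2
  induction l with
  | nil => simp at ha
  | cons b l ih =>
    have e : dropElements l' (b :: l) = Bool.rec (b :: dropElements l' l) (dropElements l' l)
      (List.rec (motive := fun _ => Bool) false
        (fun b' _ ih' => Bool.rec ih' true (Nat.beq b b')) l') := rfl
    rw [e]
    rcases List.mem_cons.1 ha with rfl | ha
    · rw [elem l' hd]
      exact List.mem_cons_self
    · generalize (List.rec (motive := fun _ => Bool) false
        (fun b' _ ih' => Bool.rec ih' true (Nat.beq b b')) l' : Bool) = q
      cases q
      · exact List.mem_cons_of_mem _ (ih ha)
      · exact ih ha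

theorem of_allMeeting {b a : ℕ} {f : ℕ → Bool} {l : List ℕ} (h : allMeeting b f l = true)
    (ha : a ∈ l) (hab : a &&& b ≠ 0) : f a = true := by
  induction l with
  | nil => simp at ha
  | cons c l ih =>
    have e : allMeeting b f (c :: l) = Bool.rec (Bool.rec false (allMeeting b f l) (f c))
      (allMeeting b f l) (Nat.beq (c &&& b) 0) := rfl
    rw [e] at h
    rcases List.mem_cons.1 ha with rfl | ha
    · have hb : Nat.beq (a &&& b) 0 = false := by
        rw [← Bool.not_eq_true, Nat.beq_eq]
        exact hab
      rw [hb] at h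
      cases hf : f a
      · rw [hf] at h
        exact absurd h Bool.false_ne_true
      · rfl
    · refine ih ?_ ha
      cases hb : Nat.beq (c &&& b) 0 <;> rw [hb] at h
      · cases hf : f c <;> rw [hf] at h
        · exact absurd h Bool.false_ne_true
        · exact h
      · exact h

theorem of_coverageThen {rem : ℕ} {cont : ℕ → Bool} {l : List ℕ} {t₁ t₂ t₃ : ℕ}
    (h : coverageThen rem cont l t₁ t₂ t₃ = true) :
    (∃ ch, cont ch = true) ∨
      ∃ j, rem.testBit j = true ∧ t₁.testBit j = false ∧ ∀ a ∈ l, a.testBit j = false := by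
  induction l generalizing t₁ t₂ t₃ with
  | nil =>
    have e : coverageThen rem cont [] t₁ t₂ t₃ = Bool.rec true
      (Bool.rec (cont (Nat.xor t₁ t₂)) (Bool.rec (cont (Nat.xor t₂ t₃)) (cont rem)
        (Nat.beq t₂ t₃)) (Nat.beq t₁ t₂)) (Nat.beq (t₁ &&& rem) rem) := rfl
    rw [e] at h
    cases h0 : Nat.beq (t₁ &&& rem) rem <;> rw [h0] at h
    · right
      rw [← Bool.not_eq_true, Nat.beq_eq] at h0
      by_contra hc
      push Not at hc
      refine h0 (Nat.eq_of_testBit_eq fun j => ?_)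
      rw [Nat.testBit_and]
      cases hj : rem.testBit j
      · simp
      · cases ht : t₁.testBit j
        · obtain ⟨a, ha, _⟩ := hc j hj ht
          simp at ha
        · rfl
    · left
      cases h1 : Nat.beq t₁ t₂ <;> rw [h1] at h
      · exact ⟨_, h⟩
      · cases h2 : Nat.beq t₂ t₃ <;> rw [h2] at h <;> exact ⟨_, h⟩
  | cons a l ih =>
    rcases ih (t₁ := t₁ ||| a) h with hc | ⟨j, hj, ht, hl⟩
    · exact Or.inl hc
    · rw [Nat.testBit_or, Bool.or_eq_false_iff] at ht
      exact Or.inr ⟨j, hj, ht.1, List.forall_mem_cons.2 ⟨ht.2, hl⟩⟩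

/-- The positions of `rem` are covered once, all others are not covered. -/
def IsCover (rem : ℕ) (L : Multiset ℕ) : Prop :=
  ∀ j, L.countP (fun a => a.testBit j = true) = if rem.testBit j = true then 1 else 0

/-- A member of an exact cover lies inside `rem`, so `xor` removes its positions, and all other
members avoid them. -/
theorem IsCover.erase {rem m : ℕ} {L : Multiset ℕ} (h : IsCover rem (m ::ₘ L)) :
    IsCover (rem ^^^ m) L ∧ ∀ a ∈ L, a &&& m = 0 := by
  have key : ∀ j, L.countP (fun a => a.testBit j = true) + (if m.testBit j = true then 1 else 0) =
      if rem.testBit j = true then 1 else 0 := fun j => by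
    rw [← Multiset.countP_cons]
    exact h j
  constructor
  · intro j
    have := key j
    rw [Nat.testBit_xor]
    cases hm : m.testBit j <;> cases hr : rem.testBit j <;> simp [hm, hr] at this ⊢ <;> omega
  · intro a ha
    refine Nat.eq_of_testBit_eq fun j => ?_
    rw [Nat.testBit_and, Nat.zero_testBit]
    have := key j
    cases haj : a.testBit j
    · rfl
    · have hpos : 0 < L.countP (fun a => a.testBit j = true) :=
        Multiset.countP_pos.2 ⟨a, ha, haj⟩
      cases hm : m.testBit j
      · rfl
      · simp only [hm, if_true] at this
        split_ifs at this; omega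

/-- Some member of the cover contains a chosen position of `rem`; it is among the candidates tried
there, and the rest of the cover contradicts the recursive refutation. If no candidate covers some
position, there is nothing to try. -/
theorem not_isCover_of_refutes {n rem : ℕ} {cands : List ℕ} (h : refutes n rem cands = true)
    {L : Multiset ℕ} (hL : ∀ a ∈ L, a ∈ cands) (hc : IsCover rem L) : False := by
  induction n generalizing rem cands L with
  | zero => exact absurd h (by simp [refutes])
  | succ n ih =>
    have e : refutes (n + 1) rem cands = coverageThen rem (fun ch =>
      (fun b => Bool.rec (allMeeting b
          (fun m => refutes n (rem ^^^ m) (keepDisjoint m cands)) cands)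
        false (Nat.beq (b &&& rem) 0)) (Nat.xor ch (Nat.land ch (Nat.sub ch 1)))) cands 0 0 0 := rfl
    rw [e] at h
    rcases of_coverageThen h with ⟨ch, hch⟩ | ⟨j, hj, -, hl⟩
    · simp only at hch
      generalize Nat.xor ch (Nat.land ch (Nat.sub ch 1)) = b at hch
      cases hb : Nat.beq (b &&& rem) 0 <;> rw [hb] at hch
      · rw [← Bool.not_eq_true, Nat.beq_eq] at hb
        obtain ⟨j, hj⟩ := Nat.exists_testBit_of_ne_zero hb
        rw [Nat.testBit_and, Bool.and_eq_true] at hj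
        have hcj := hc j
        rw [if_pos hj.2] at hcj
        obtain ⟨m, hm, hmj⟩ := Multiset.countP_pos.1 (by rw [hcj]; exact Nat.one_pos :
          0 < L.countP (fun a => a.testBit j = true))
        have hmb : m &&& b ≠ 0 := fun h0 => by
          have := congrArg (fun t => Nat.testBit t j) h0
          simp [hmj, hj.1] at this
        obtain ⟨L', rfl⟩ := Multiset.exists_cons_of_mem hm
        obtain ⟨hc', hd⟩ := hc.erase
        exact ih (of_allMeeting hch (hL m hm) hmb)
          (fun a ha => mem_keepDisjoint (hL a (Multiset.mem_cons_of_mem ha)) (hd a ha)) hc'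
      · exact absurd hch Bool.false_ne_true
    · have hcj := hc j
      rw [if_pos hj] at hcj
      obtain ⟨m, hm, hmj⟩ := Multiset.countP_pos.1 (by rw [hcj]; exact Nat.one_pos :
          0 < L.countP (fun a => a.testBit j = true))
      rw [hl m (hL m hm)] at hmj
      exact absurd hmj Bool.false_ne_true

/-! ### Columns of a perfect difference matrix as masks -/

/-- The six differences of a column whose entries have been shifted by `m / 2`, as a mask. -/
def natMask (m x y z : ℕ) : ℕ :=
  2 ^ (6 * x) ||| 2 ^ (6 * y + 1) ||| 2 ^ (6 * z + 2) ||| 2 ^ (6 * (y + m / 2 - x) + 3) |||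
    2 ^ (6 * (z + m / 2 - x) + 4) ||| 2 ^ (6 * (z + m / 2 - y) + 5)

def columnMask (m : ℕ) (c : ℤ × ℤ × ℤ) : ℕ :=
  natMask m (c.1 + (m / 2 : ℕ)).toNat (c.2.1 + (m / 2 : ℕ)).toNat (c.2.2 + (m / 2 : ℕ)).toNat

def candidateMasks (m : ℕ) : List ℕ :=
  (List.range m).flatMap fun x => (List.range m).flatMap fun y =>
    bif Nat.ble x (y + m / 2) && Nat.ble y (x + m / 2) then
      (List.range m).filterMap fun z =>
        bif Nat.ble z (x + m / 2) && Nat.ble x (z + m / 2) &&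
            (Nat.ble y (z + m / 2) && Nat.ble z (y + m / 2)) then some (natMask m x y z)
        else none
    else []

theorem testBit_natMask {m x y z j : ℕ} : (natMask m x y z).testBit j = true ↔
    6 * x = j ∨ 6 * y + 1 = j ∨ 6 * z + 2 = j ∨ 6 * (y + m / 2 - x) + 3 = j ∨
      6 * (z + m / 2 - x) + 4 = j ∨ 6 * (z + m / 2 - y) + 5 = j := by
  simp only [natMask, Nat.testBit_or, Nat.testBit_two_pow, Bool.or_eq_true, decide_eq_true_iff,
    or_assoc]

theorem natMask_injective {m x y z x' y' z' : ℕ} (h : natMask m x y z = natMask m x' y' z') :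
    x = x' ∧ y = y' ∧ z = z' := by
  have key : ∀ j, (natMask m x y z).testBit j = true → (natMask m x' y' z').testBit j = true :=
    fun j hj => h ▸ hj
  have hx := testBit_natMask.1 (key (6 * x) (testBit_natMask.2 (by omega)))
  have hy := testBit_natMask.1 (key (6 * y + 1) (testBit_natMask.2 (by omega)))
  have hz := testBit_natMask.1 (key (6 * z + 2) (testBit_natMask.2 (by omega)))
  omega

/-- All differences of the column lie in `interval m`. -/
def InRange (m : ℕ) (c : ℤ × ℤ × ℤ) : Prop :=
  ∀ i, edges c i ∈ interval m

theorem inRange_iff {m : ℕ} {c : ℤ × ℤ × ℤ} : InRange m c ↔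
    c.1.natAbs ≤ m / 2 ∧ c.2.1.natAbs ≤ m / 2 ∧ c.2.2.natAbs ≤ m / 2 ∧
      (c.2.1 - c.1).natAbs ≤ m / 2 ∧ (c.2.2 - c.1).natAbs ≤ m / 2 ∧
      (c.2.2 - c.2.1).natAbs ≤ m / 2 := by
  have key : ∀ d : ℤ, d ∈ interval m ↔ d.natAbs ≤ m / 2 := fun d => by
    rw [mem_interval]; omega
  constructor
  · intro h
    exact ⟨(key _).1 (h 0), (key _).1 (h 1), (key _).1 (h 2), (key _).1 (h 3), (key _).1 (h 4),
      (key _).1 (h 5)⟩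
  · rintro ⟨h0, h1, h2, h3, h4, h5⟩ i
    rw [key]
    fin_cases i
    exacts [h0, h1, h2, h3, h4, h5]

theorem columnMask_injective {m : ℕ} {c d : ℤ × ℤ × ℤ} (hc : InRange m c) (hd : InRange m d)
    (h : columnMask m c = columnMask m d) : c = d := by
  rw [inRange_iff] at hc hd
  obtain ⟨x, y, z⟩ := c
  obtain ⟨x', y', z'⟩ := d
  have := natMask_injective h
  simp only [Prod.mk.injEq] at this hc hd ⊢
  omega

theorem natMask_mem_candidateMasks {m x y z : ℕ} (hx : x < m) (hy : y < m) (hz : z < m)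
    (h : x ≤ y + m / 2 ∧ y ≤ x + m / 2 ∧ z ≤ x + m / 2 ∧ x ≤ z + m / 2 ∧ y ≤ z + m / 2 ∧
      z ≤ y + m / 2) : natMask m x y z ∈ candidateMasks m := by
  refine List.mem_flatMap.2 ⟨x, List.mem_range.2 hx, List.mem_flatMap.2
    ⟨y, List.mem_range.2 hy, ?_⟩⟩
  simp only [Nat.ble_eq_true_of_le h.1, Nat.ble_eq_true_of_le h.2.1, Bool.and_self, cond_true]
  refine List.mem_filterMap.2 ⟨z, List.mem_range.2 hz, ?_⟩
  simp only [Nat.ble_eq_true_of_le h.2.2.1, Nat.ble_eq_true_of_le h.2.2.2.1,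
    Nat.ble_eq_true_of_le h.2.2.2.2.1, Nat.ble_eq_true_of_le h.2.2.2.2.2, Bool.and_self, cond_true]

theorem columnMask_mem_candidateMasks {m : ℕ} (hm : Odd m) {c : ℤ × ℤ × ℤ} (hc : InRange m c) :
    columnMask m c ∈ candidateMasks m := by
  rw [inRange_iff] at hc
  obtain ⟨r, rfl⟩ := hm
  exact natMask_mem_candidateMasks (by omega) (by omega) (by omega) (by omega)

/-- Bit `6 * v + i` encodes that the `i`-th difference, shifted by `m / 2`, equals `v`. -/
theorem testBit_columnMask {m : ℕ} {c : ℤ × ℤ × ℤ} (hc : InRange m c) (j : ℕ) :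
    (columnMask m c).testBit j = true ↔
      edges c ⟨j % 6, Nat.mod_lt _ (by decide)⟩ = ((j / 6 : ℕ) : ℤ) - (m / 2 : ℕ) := by
  rw [inRange_iff] at hc
  obtain ⟨x, y, z⟩ := c
  rw [columnMask, testBit_natMask]
  generalize m / 2 = r at hc ⊢
  obtain ⟨h0, h1, h2, h3, h4, h5⟩ := hc
  simp only at h0 h1 h2 h3 h4 h5 ⊢
  -- The range conditions make every `toNat` and every truncated subtraction exact; after naming the
  -- results the claim is linear.
  obtain ⟨X, hX⟩ : ∃ X : ℕ, x + r = X := ⟨_, (Int.toNat_of_nonneg (by omega)).symm⟩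
  obtain ⟨Y, hY⟩ : ∃ Y : ℕ, y + r = Y := ⟨_, (Int.toNat_of_nonneg (by omega)).symm⟩
  obtain ⟨Z, hZ⟩ : ∃ Z : ℕ, z + r = Z := ⟨_, (Int.toNat_of_nonneg (by omega)).symm⟩
  obtain ⟨U, hU⟩ : ∃ U, Y + r - X = U ∧ Y + r = X + U := ⟨_, rfl, by omega⟩
  obtain ⟨V, hV⟩ : ∃ V, Z + r - X = V ∧ Z + r = X + V := ⟨_, rfl, by omega⟩
  obtain ⟨W, hW⟩ : ∃ W, Z + r - Y = W ∧ Z + r = Y + W := ⟨_, rfl, by omega⟩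
  rw [hX, hY, hZ, Int.toNat_natCast, Int.toNat_natCast, Int.toNat_natCast, hU.1, hV.1, hW.1]
  replace hU := hU.2
  replace hV := hV.2
  replace hW := hW.2
  clear h0 h1 h2 h3 h4 h5
  obtain ⟨q, p, hp, rfl⟩ : ∃ q p, p < 6 ∧ j = 6 * q + p :=
    ⟨j / 6, j % 6, Nat.mod_lt _ (by decide), (Nat.div_add_mod j 6).symm⟩
  simp only [show (6 * q + p) / 6 = q by omega, show (6 * q + p) % 6 = p by omega]
  interval_cases p
  · change _ ↔ x = _
    omega
  · change _ ↔ y = _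
    omega
  · change _ ↔ z = _
    omega
  · change _ ↔ y - x = _
    omega
  · change _ ↔ z - x = _
    omega
  · change _ ↔ z - y = _
    omega

namespace Solves

variable {m : ℕ} {K : Multiset (ℤ × ℤ × ℤ)}

theorem inRange (hK : Solves K (interval m).val) {c : ℤ × ℤ × ℤ} (hc : c ∈ K) : InRange m c :=
  fun i => by
    rw [← Finset.mem_val, ← hK i]
    exact Multiset.mem_map_of_mem _ hc

theorem isCover (hm : Odd m) (hK : Solves K (interval m).val) :
    IsCover (2 ^ (6 * m) - 1) (K.map (columnMask m)) := by
  intro j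
  set i : Fin 6 := ⟨j % 6, Nat.mod_lt _ (by decide)⟩
  set v : ℤ := ((j / 6 : ℕ) : ℤ) - (m / 2 : ℕ)
  have h1 : (K.map (columnMask m)).countP (fun a => a.testBit j = true) =
      (interval m).val.count v := by
    rw [← hK i, Multiset.countP_map, Multiset.count_map, ← Multiset.countP_eq_card_filter]
    rw [← Multiset.countP_eq_card_filter]
    refine Multiset.countP_congr rfl fun c hc => ?_
    rw [testBit_columnMask (hK.inRange hc)]
    exact propext ⟨Eq.symm, Eq.symm⟩
  rw [h1, Multiset.count_eq_of_nodup (interval m).nodup]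
  have h2 : v ∈ (interval m).val ↔ (2 ^ (6 * m) - 1).testBit j = true := by
    rw [Nat.testBit_two_pow_sub_one, decide_eq_true_iff, Finset.mem_val, mem_interval]
    obtain ⟨r, rfl⟩ := hm
    omega
  simp only [h2]

end Solves

/-! ### Symmetries -/

/-- The column occurs in some solution of order `m`. -/
def Occurs (m : ℕ) (c : ℤ × ℤ × ℤ) : Prop :=
  ∃ K, Solves K (interval m).val ∧ c ∈ K

theorem map_neg_interval (m : ℕ) :
    (interval m).val.map (fun d => -1 * d) = (interval m).val := by
  refine Finset.val_eq_of_card_le (fun t ht => ?_) (by simp)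
  rw [mem_interval] at ht
  refine Multiset.mem_map.2 ⟨-t, ?_, by ring⟩
  rw [Finset.mem_val, mem_interval]
  omega

/-- A map of columns that permutes the six differences up to sign preserves solutions, because
`interval m` is symmetric. -/
theorem Occurs.map {m : ℕ} {c : ℤ × ℤ × ℤ} (hc : Occurs m c) (f : ℤ × ℤ × ℤ → ℤ × ℤ × ℤ)
    (π : Fin 6 → Fin 6) (s : Fin 6 → ℤ) (hs : ∀ i, s i = 1 ∨ s i = -1)
    (h : ∀ c i, edges (f c) i = s i * edges c (π i)) : Occurs m (f c) := by
  obtain ⟨K, hK, hcK⟩ := hc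
  refine ⟨K.map f, fun i => ?_, Multiset.mem_map_of_mem f hcK⟩
  have e : K.map (fun c => s i * edges c (π i)) =
      (K.map fun c => edges c (π i)).map (fun d => s i * d) := by
    rw [Multiset.map_map]; rfl
  rw [Multiset.map_map]
  simp only [Function.comp_def, h]
  rw [e, hK]
  rcases hs i with hi | hi <;> rw [hi]
  · simp
  · exact map_neg_interval m

/-- The images of a column under permutations of the four points and reflection. -/
def images (c : ℤ × ℤ × ℤ) : List (ℤ × ℤ × ℤ) :=
  ((([c, (-c.1, c.2.1 - c.1, c.2.2 - c.1), (c.1 - c.2.1, -c.2.1, c.2.2 - c.2.1),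
      (c.1 - c.2.2, c.2.1 - c.2.2, -c.2.2)].flatMap
    fun c => [c, (c.2.1, c.2.2, c.1), (c.2.2, c.1, c.2.1)]).flatMap
    fun c => [c, (c.1, c.2.2, c.2.1)]).flatMap fun c => [c, (-c.1, -c.2.1, -c.2.2)])

/-- An image arises by a choice of base point, a rotation and a transposition of the other points,
and a reflection. These are undone in reverse order, each inverse being a symmetry of solutions. -/
theorem Occurs.of_mem_images {m : ℕ} {c d : ℤ × ℤ × ℤ} (hd : Occurs m d) (h : d ∈ images c) :
    Occurs m c := by
  obtain ⟨c₃, h₃, h⟩ := List.mem_flatMap.1 h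
  obtain ⟨c₂, h₂, h₃⟩ := List.mem_flatMap.1 h₃
  obtain ⟨c₁, h₁, h₂⟩ := List.mem_flatMap.1 h₂
  have o₃ : Occurs m c₃ := by
    simp only [List.mem_cons, List.not_mem_nil, or_false] at h
    rcases h with rfl | rfl
    · exact hd
    · simpa using hd.map (fun c => (-c.1, -c.2.1, -c.2.2)) ![0, 1, 2, 3, 4, 5]
        ![-1, -1, -1, -1, -1, -1] (by decide) (fun c i => by fin_cases i <;> simp [edges] <;> ring)
  have o₂ : Occurs m c₂ := by
    simp only [List.mem_cons, List.not_mem_nil, or_false] at h₃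
    rcases h₃ with rfl | rfl
    · exact o₃
    · simpa using o₃.map (fun c => (c.1, c.2.2, c.2.1)) ![0, 2, 1, 4, 3, 5]
        ![1, 1, 1, 1, 1, -1] (by decide) (fun c i => by fin_cases i <;> simp [edges])
  have o₁ : Occurs m c₁ := by
    simp only [List.mem_cons, List.not_mem_nil, or_false] at h₂
    rcases h₂ with rfl | rfl | rfl
    · exact o₂
    · simpa using o₂.map (fun c => (c.2.2, c.1, c.2.1)) ![2, 0, 1, 4, 5, 3]
        ![1, 1, 1, -1, -1, 1] (by decide) (fun c i => by fin_cases i <;> simp [edges])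
    · simpa using o₂.map (fun c => (c.2.1, c.2.2, c.1)) ![1, 2, 0, 5, 3, 4]
        ![1, 1, 1, 1, -1, -1] (by decide) (fun c i => by fin_cases i <;> simp [edges])
  simp only [List.mem_cons, List.not_mem_nil, or_false] at h₁
  rcases h₁ with rfl | rfl | rfl | rfl
  · exact o₁
  · simpa using o₁.map (fun c => (-c.1, c.2.1 - c.1, c.2.2 - c.1)) ![0, 3, 4, 1, 2, 5]
      ![-1, 1, 1, 1, 1, 1] (by decide) (fun c i => by fin_cases i <;> simp [edges])
  · simpa using o₁.map (fun c => (c.1 - c.2.1, -c.2.1, c.2.2 - c.2.1)) ![3, 1, 5, 0, 4, 2]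
      ![-1, -1, 1, -1, 1, 1] (by decide) (fun c i => by fin_cases i <;> simp [edges] <;> ring)
  · simpa using o₁.map (fun c => (c.1 - c.2.2, c.2.1 - c.2.2, -c.2.2)) ![4, 5, 2, 3, 0, 1]
      ![-1, -1, -1, 1, -1, -1] (by decide) (fun c i => by fin_cases i <;> simp [edges] <;> ring)

/-! ### Nonexistence -/

/-- For each of the given columns in turn, exclude it and drop its images from the candidates;
in the end no candidate with first entry `m / 2` is left. -/
def refutesOrder (m : ℕ) : List (ℤ × ℤ × ℤ) → List ℕ → Bool
  -- For odd `m` this bit encodes first entry `m / 2`, as `m / 2 + m / 2 = m - 1`.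
  | [], cands => allMeeting (2 ^ (6 * (m - 1))) (fun _ => false) cands
  | c :: cs, cands =>
    refutes m ((2 ^ (6 * m) - 1) ^^^ columnMask m c) (keepDisjoint (columnMask m c) cands) &&
      (((images c).all fun d => decide (d.1.natAbs ≤ m / 2 ∧ d.2.1.natAbs ≤ m / 2 ∧
        d.2.2.natAbs ≤ m / 2 ∧ (d.2.1 - d.1).natAbs ≤ m / 2 ∧ (d.2.2 - d.1).natAbs ≤ m / 2 ∧
        (d.2.2 - d.2.1).natAbs ≤ m / 2)) &&
      refutesOrder m cs (dropElements ((images c).map (columnMask m)) cands))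

theorem not_realizes_of_refutesOrder {m : ℕ} (hm : Odd m) {cs : List (ℤ × ℤ × ℤ)}
    {cands : List ℕ} (h : refutesOrder m cs cands = true)
    (hcands : ∀ c, Occurs m c → columnMask m c ∈ cands) : ¬ Realizes (interval m).val := by
  induction cs generalizing cands with
  | nil =>
    rintro ⟨K, hK⟩
    -- The largest value must be the first entry of some column.
    have hr : ((m / 2 : ℕ) : ℤ) ∈ (interval m).val := by
      rw [Finset.mem_val, mem_interval]; omega
    rw [← hK 0] at hr
    obtain ⟨c, hc, hcr⟩ := Multiset.mem_map.1 hr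
    have hmem := hcands c ⟨K, hK, hc⟩
    refine absurd (of_allMeeting h hmem fun h0 => ?_) Bool.false_ne_true
    have hbit : (columnMask m c).testBit (6 * (m - 1)) = true := by
      rw [columnMask, testBit_natMask]
      have : c.1 = ((m / 2 : ℕ) : ℤ) := hcr
      obtain ⟨r, rfl⟩ := hm
      left
      omega
    have := congrArg (fun t => Nat.testBit t (6 * (m - 1))) h0
    simp [hbit] at this
  | cons c cs ih =>
    rw [refutesOrder, Bool.and_eq_true, Bool.and_eq_true] at h
    obtain ⟨h₁, h₂, h₃⟩ := h
    have hno : ¬ Occurs m c := by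
      rintro ⟨K, hK, hc⟩
      obtain ⟨K', rfl⟩ := Multiset.exists_cons_of_mem hc
      have hcov := hK.isCover hm
      rw [Multiset.map_cons] at hcov
      obtain ⟨hcov, hd⟩ := hcov.erase
      refine not_isCover_of_refutes h₁ (fun a ha => mem_keepDisjoint ?_ (hd a ha)) hcov
      obtain ⟨d, hdK, rfl⟩ := Multiset.mem_map.1 ha
      exact hcands d ⟨_, hK, Multiset.mem_cons_of_mem hdK⟩
    refine ih h₃ fun d hd => mem_dropElements (hcands d hd) fun hmem => ?_
    obtain ⟨d', hd', he⟩ := List.mem_map.1 hmem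
    -- A mask determines its column only within range, hence the range test on all images.
    have hr' : InRange m d' := inRange_iff.2 (of_decide_eq_true (List.all_eq_true.1 h₂ d' hd'))
    obtain ⟨K, hK, hdK⟩ := hd
    obtain rfl := columnMask_injective hr' (hK.inRange hdK) he
    exact hno (Occurs.of_mem_images ⟨K, hK, hdK⟩ hd')

theorem not_realizes_of_candidates {m : ℕ} (hm : Odd m) {cs : List (ℤ × ℤ × ℤ)}
    (h : refutesOrder m cs (candidateMasks m) = true) : ¬ Realizes (interval m).val :=
  not_realizes_of_refutesOrder hm h fun _ ⟨_, hK, hc⟩ =>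
    columnMask_mem_candidateMasks hm (hK.inRange hc)

-- If the first entry is `4`, the other two lie between `0` and `4`. Up to exchanging them and
-- reflecting by `y ↦ 4 - y`, exactly the nine listed columns remain; for order `11` the same count
-- with `5` gives twelve.
set_option maxRecDepth 100000 in
theorem not_realizes_nine : ¬ Realizes (interval 9).val :=
  not_realizes_of_candidates (by decide)
    (cs := [(4, 0, 1), (4, 0, 0), (4, 1, 2), (4, 0, 3), (4, 2, 2), (4, 0, 4), (4, 0, 2), (4, 1, 3),
      (4, 1, 1)]) (by decide +kernel)

set_option maxRecDepth 100000 in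
theorem not_realizes_eleven : ¬ Realizes (interval 11).val :=
  not_realizes_of_candidates (by decide)
    (cs := [(5, 1, 3), (5, 0, 4), (5, 0, 2), (5, 1, 4), (5, 0, 3), (5, 0, 1), (5, 2, 2), (5, 0, 0),
      (5, 0, 5), (5, 1, 1), (5, 1, 2), (5, 2, 3)]) (by decide +kernel)

/-! ### The tables -/

/-- Columns of perfect difference matrices; a zero column is left out. -/
def columnTable : List (ℕ × List (ℤ × ℤ × ℤ)) := [
  -- For `5`, `7` and `15` the number of columns is odd: zero is among the values taken, and these
  -- orders enter as merely perfect.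
  (5, [(-2, -2, -1), (-1, 1, 1), (0, -1, -2), (1, 2, 0), (2, 0, 2)]),
  (7, [(-3, -3, -3), (-2, -1, 1), (-1, 1, -2), (0, 3, 2), (1, -2, -1), (2, 0, 3), (3, 2, 0)]),
  (15, [(-7, -4, 0), (-6, -2, -3), (-5, 0, -6), (-4, -5, -7), (-3, -7, -2), (-2, 5, 2),
    (-1, -6, 1), (0, 6, 6), (1, 2, -5), (2, 4, 7), (3, 1, -4), (4, -3, -1), (5, -1, 5), (6, 3, 4),
    (7, 7, 3)]),
  (17, [(-8, -5, -2), (-7, -8, -4), (-6, -2, -7), (-5, -4, 2), (-4, 4, -3), (-3, 2, -6),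
    (-2, -7, -8), (-1, 5, 7), (1, 8, 6), (2, -6, -5), (3, -3, 5), (4, 1, 8), (5, 7, 1), (6, -1, 4),
    (7, 3, -1), (8, 6, 3)]),
  (19, [(-9, -6, -2), (-8, -1, -7), (-7, -8, -1), (-6, -2, -9), (-5, -4, 4), (-4, 4, -5),
    (-3, 6, 2), (-2, -9, -6), (-1, -7, -8), (1, 7, 9), (2, -3, 6), (3, 8, 5), (4, -5, -4),
    (5, 3, 8), (6, 2, -3), (7, 9, 1), (8, 5, 3), (9, 1, 7)]),
  (21, [(-10, -4, -8), (-9, -5, 1), (-8, -3, -10), (-7, 3, -6), (-6, -9, -1), (-5, -7, 3),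
    (-4, -8, -5), (-3, -10, -9), (-2, 7, 2), (-1, 6, 8), (1, 9, 7), (2, 4, 9), (3, -6, -7),
    (4, -1, -4), (5, 8, -2), (6, 5, -3), (7, 1, 10), (8, -2, 5), (9, 10, 4), (10, 2, 6)]),
  (23, [(-11, -10, -5), (-10, -7, -3), (-9, 1, -7), (-8, -3, -9), (-7, -5, 4), (-6, 3, -8),
    (-5, -11, -1), (-4, -8, -10), (-3, 5, 6), (-2, -4, -11), (-1, 10, 7), (1, 8, 11), (2, -9, -2),
    (3, 9, 8), (4, -6, -4), (5, 4, -6), (6, -2, 9), (7, 11, 2), (8, -1, 5), (9, 2, 10), (10, 7, 3),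
    (11, 6, 1)]),
  (25, [(-12, -9, -2), (-11, 1, -7), (-10, -5, -4), (-9, -2, -12), (-8, -6, 3), (-7, -11, 1),
    (-6, 3, -8), (-5, -4, -10), (-4, -10, -5), (-3, 8, 6), (-2, -12, -9), (-1, 7, 11),
    (1, -7, -11), (2, 12, 9), (3, -8, -6), (4, 10, 5), (5, 4, 10), (6, -3, 8), (7, 11, -1),
    (8, 6, -3), (9, 2, 12), (10, 5, 4), (11, -1, 7), (12, 9, 2)]),
  (27, [(-13, -5, -9), (-12, 1, -10), (-11, -10, -2), (-10, -4, -11), (-9, -12, -6), (-8, -9, 3),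
    (-7, -11, -13), (-6, -2, 7), (-5, -13, -12), (-4, 6, -7), (-3, -8, 2), (-2, 10, 5),
    (-1, 8, 11), (1, 12, 9), (2, 7, 12), (3, 5, -5), (4, -3, 10), (5, -7, -8), (6, 13, 4),
    (7, -6, -4), (8, 11, -1), (9, 3, -3), (10, -1, 6), (11, 9, 1), (12, 2, 13), (13, 4, 8)]),
  (29, [(-14, -9, -3), (-13, -3, -14), (-12, -13, -6), (-11, 3, -10), (-10, -2, 2), (-9, 4, -4),
    (-8, -4, -13), (-7, -6, 6), (-6, -11, 3), (-5, 7, 9), (-4, -12, -2), (-3, 8, 7), (-2, -14, -9),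
    (-1, -8, -11), (1, -10, -7), (2, -7, -12), (3, 10, 11), (4, 2, -8), (5, 14, 12), (6, 9, -5),
    (7, 13, 1), (8, -5, 4), (9, 5, 13), (10, 12, 8), (11, 1, 14), (12, 6, -1), (13, -1, 10),
    (14, 11, 5)]),
  (33, [(-16, -2, -7), (-15, -16, -5), (-14, -1, -8), (-13, 3, -6), (-12, -14, -4), (-11, -10, 5),
    (-10, -8, 4), (-9, -3, -16), (-8, 4, 3), (-7, 1, -13), (-6, 5, 9), (-5, 2, -14), (-4, -15, -9),
    (-3, 12, 10), (-2, -12, -15), (-1, -4, -12), (1, -11, -3), (2, -13, -10), (3, 13, 15),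
    (4, -5, -11), (5, -9, 7), (6, 15, 11), (7, -6, 8), (8, 11, 12), (9, -7, 6), (10, 14, 2),
    (11, 16, 1), (12, 8, -2), (13, 7, 16), (14, 6, 13), (15, 10, -1), (16, 9, 14)]),
  (35, [(-17, -5, -11), (-16, -1, -13), (-15, -7, -2), (-14, -11, 2), (-13, 1, -9), (-12, -2, -5),
    (-11, -15, 1), (-10, -6, -14), (-9, -16, -1), (-8, 9, 7), (-7, 2, -15), (-6, -9, 5),
    (-5, -17, -8), (-4, -10, -17), (-3, 10, 11), (-2, -12, -16), (-1, 5, 16), (1, 17, 6),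
    (2, -14, -10), (3, 14, 13), (4, -13, -6), (5, -3, -12), (6, 11, -3), (7, -8, 9), (8, 15, 17),
    (9, 8, -7), (10, -4, 4), (11, 12, -4), (12, 7, 10), (13, 4, 14), (14, 16, 3), (15, 13, 8),
    (16, 3, 15), (17, 6, 12)]),
  (37, [(-18, -5, -15), (-17, -18, -4), (-16, -14, -5), (-15, -6, -17), (-14, -13, 4),
    (-13, -7, -3), (-12, -1, -8), (-11, 6, -9), (-10, 5, -13), (-9, -11, 5), (-8, 8, 7),
    (-7, 1, -11), (-6, 12, 10), (-5, -17, -14), (-4, -10, 3), (-3, 9, 14), (-2, -12, -18),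
    (-1, -8, -16), (1, -15, -7), (2, -16, -10), (3, 17, 12), (4, 7, -6), (5, -9, -12), (6, 16, 18),
    (7, -4, 8), (8, 15, 16), (9, 14, -2), (10, -3, 15), (11, 2, 17), (12, 4, 11), (13, 10, 6),
    (14, 18, 1), (15, -2, 9), (16, 11, 2), (17, 13, -1), (18, 3, 13)]),
  (39, [(-19, -12, -13), (-18, -3, -14), (-17, 2, -10), (-16, -17, -8), (-15, -10, 4),
    (-14, -19, -4), (-13, -1, -18), (-12, 5, 3), (-11, -14, 2), (-10, -9, -16), (-9, -11, 8),
    (-8, 1, -12), (-7, -18, -15), (-6, -15, -19), (-5, 11, -7), (-4, 9, 14), (-3, 3, 11),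
    (-2, 16, 10), (-1, -7, -17), (1, -16, -6), (2, 12, 18), (3, 14, 6), (4, 18, 13), (5, -2, 16),
    (6, -13, -9), (7, -8, -11), (8, -4, 9), (9, 17, -2), (10, -6, 1), (11, 13, -3), (12, 15, 17),
    (13, -5, 12), (14, 10, -5), (15, 19, 5), (16, 8, -1), (17, 7, 19), (18, 4, 15), (19, 6, 7)]),
  (41, [(-20, -17, -8), (-19, -8, -12), (-18, -20, -5), (-17, -2, -18), (-16, 2, -15),
    (-15, -13, 5), (-14, 3, -9), (-13, -6, 1), (-12, -3, -17), (-11, -15, -20), (-10, 4, 6),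
    (-9, -12, 8), (-8, 11, 10), (-7, -14, -1), (-6, -19, -16), (-5, 15, 4), (-4, 8, -11),
    (-3, 10, 16), (-2, -16, -6), (-1, -11, -19), (1, -18, -10), (2, -4, -14), (3, 19, 13),
    (4, -7, 12), (5, 9, 20), (6, -10, -13), (7, 6, -7), (8, 18, 19), (9, 17, -3), (10, 16, 14),
    (11, -9, -4), (12, -5, 9), (13, 14, 7), (14, 5, 17), (15, 20, 2), (16, 1, 18), (17, -1, 15),
    (18, 13, -2), (19, 7, 11), (20, 12, 3)]),
  (43, [(-21, -9, -11), (-20, -6, -14), (-19, -1, -8), (-18, -17, 3), (-17, 3, -18), (-16, -3, 1),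
    (-15, -10, 5), (-14, -20, -6), (-13, -2, 6), (-12, 7, -7), (-11, -21, -9), (-10, 5, -15),
    (-9, -11, -21), (-8, -19, -1), (-7, -12, 7), (-6, -14, -20), (-5, 16, 13), (-4, 12, 11),
    (-3, 1, -16), (-2, 6, -13), (-1, -8, -19), (1, -16, -3), (2, 19, 15), (3, -18, -17),
    (4, 14, 20), (5, -15, -10), (6, -13, -2), (7, -7, -12), (8, 10, 17), (9, 18, 21), (10, 17, 8),
    (11, -4, 12), (12, 11, -4), (13, -5, 16), (14, 20, 4), (15, 2, 19), (16, 13, -5), (17, 8, 10),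
    (18, 21, 9), (19, 15, 2), (20, 4, 14), (21, 9, 18)]),
  (47, [(-23, -9, -16), (-22, -23, -13), (-21, -6, -4), (-20, 2, -9), (-19, -1, -14),
    (-18, -15, -20), (-17, -8, -23), (-16, 4, -17), (-15, -20, -2), (-14, -12, 5), (-13, -21, -1),
    (-12, -5, 11), (-11, -22, -21), (-10, -14, 8), (-9, 7, -12), (-8, 13, 7), (-7, 3, 15),
    (-6, -18, -22), (-5, -11, 3), (-4, 19, 10), (-3, 10, 18), (-2, 17, -6), (-1, 16, 19),
    (1, -16, -19), (2, -17, 6), (3, -10, -18), (4, -19, -10), (5, 11, -3), (6, 18, 22),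
    (7, -3, -15), (8, -13, -7), (9, -7, 12), (10, 14, -8), (11, 22, 21), (12, 5, -11), (13, 21, 1),
    (14, 12, -5), (15, 20, 2), (16, -4, 17), (17, 8, 23), (18, 15, 20), (19, 1, 14), (20, -2, 9),
    (21, 6, 4), (22, 23, 13), (23, 9, 16)]),
  (55, [(-27, -3, -18), (-26, -13, -21), (-25, -5, -8), (-24, -10, 2), (-23, -12, 4),
    (-22, -1, -20), (-21, -26, -13), (-20, -22, -1), (-19, -9, -15), (-18, -27, -3), (-17, -16, 6),
    (-16, 6, -17), (-15, -19, -9), (-14, -7, 11), (-13, -21, -26), (-12, 4, -23), (-11, 14, 7),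
    (-10, 2, -24), (-9, -15, -19), (-8, -25, -5), (-7, 11, -14), (-6, 17, 16), (-5, -8, -25),
    (-4, 23, 12), (-3, -18, -27), (-2, 24, 10), (-1, -20, -22), (1, 20, 22), (2, -24, -10),
    (3, 18, 27), (4, -23, -12), (5, 8, 25), (6, -17, -16), (7, -11, 14), (8, 25, 5), (9, 15, 19),
    (10, -2, 24), (11, -14, -7), (12, -4, 23), (13, 21, 26), (14, 7, -11), (15, 19, 9),
    (16, -6, 17), (17, 16, -6), (18, 27, 3), (19, 9, 15), (20, 22, 1), (21, 26, 13), (22, 1, 20),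
    (23, 12, -4), (24, 10, -2), (25, 5, 8), (26, 13, 21), (27, 3, 18)]),
  (59, [(-29, -16, -10), (-28, -6, -20), (-27, 2, -18), (-26, -10, -21), (-25, -21, 2),
    (-24, -1, -26), (-23, -3, -11), (-22, -13, 6), (-21, -25, -7), (-20, -23, -13), (-19, -8, -24),
    (-18, 3, 7), (-17, -19, 3), (-16, -17, 10), (-15, -20, -29), (-14, 10, 8), (-13, -29, -12),
    (-12, -26, -19), (-11, 4, -22), (-10, 17, 5), (-9, -24, -27), (-8, 11, -17), (-7, 18, 17),
    (-6, -15, -28), (-5, -28, 1), (-4, -12, 12), (-3, 23, 18), (-2, -27, -6), (-1, 13, 28),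
    (1, 29, 14), (2, -4, -25), (3, 21, 26), (4, 16, -8), (5, 6, -23), (6, -22, -9), (7, 24, 25),
    (8, -9, 19), (9, -18, -15), (10, 15, 27), (11, -11, 15), (12, -7, -14), (13, 1, -16),
    (14, 22, 24), (15, -14, -5), (16, 26, -1), (17, 20, -2), (18, 25, 21), (19, -5, 11),
    (20, 7, -3), (21, 14, -4), (22, 28, 9), (23, 12, 20), (24, -2, 23), (25, 27, 4), (26, 5, 16),
    (27, 9, 29), (28, 8, 22), (29, 19, 13)])]

def designTable : List (ℕ × Design) := [
  (51, ⟨[(7, 7)], [(5, 13, 4, 2)], [(3, 8, 12), (9, 1, 15)]⟩),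
  (57, ⟨[], [(11, 1, 9, 5)], [(2, 17, 8), (3, 13, 7), (4, 18, 6)]⟩),
  (63, ⟨[(7, 5)], [(7, 2, 19, 1)], [(3, 13, 11), (4, 14, 12), (6, 17, 8)]⟩),
  (67, ⟨[(7, 4)], [], [(1, 16, 10), (2, 23, 5), (3, 18, 11), (7, 15, 9), (13, 6, 14)]⟩),
  (71, ⟨[(15, 5)], [(3, 4, 22, 2)], [(1, 17, 16), (8, 6, 13), (9, 12, 11)]⟩),
  (77, ⟨[(17, 4)], [], [(1, 17, 13), (2, 21, 14), (5, 22, 11), (7, 3, 26), (9, 6, 19)]⟩),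
  (83, ⟨[(7, 8), (17, 5)], [], [(1, 11, 26), (2, 27, 4), (3, 19, 17), (6, 7, 21), (9, 14, 18)]⟩),
  (87, ⟨[(19, 4)], [(5, 22, 3, 10)], [(1, 17, 21), (6, 23, 14), (7, 19, 15), (9, 2, 31)]⟩),
  (91, ⟨[(19, 4)], [], [(1, 21, 19), (2, 33, 10), (3, 27, 7), (5, 13, 26), (9, 14, 15),
    (11, 6, 25)]⟩),
  (97, ⟨[], [], [(1, 24, 16), (3, 31, 5), (4, 2, 42), (7, 20, 10), (8, 13, 22), (9, 23, 15),
    (12, 14, 19), (17, 11, 18)]⟩),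
  (99, ⟨[(19, 4)], [(2, 21, 17, 5)], [(1, 29, 18), (3, 10, 31), (6, 19, 14), (7, 27, 15),
    (9, 26, 11)]⟩),
  (107, ⟨[(23, 4)], [], [(1, 25, 17), (2, 47, 3), (6, 29, 10), (7, 14, 27), (9, 22, 15),
    (13, 5, 33), (19, 11, 23)]⟩),
  (111, ⟨[(19, 4)], [(3, 18, 22, 9)], [(1, 26, 15), (2, 44, 7), (5, 34, 11), (6, 29, 19),
    (10, 23, 14), (17, 13, 25)]⟩),
  (117, ⟨[(21, 4)], [], [(2, 44, 3), (5, 13, 37), (6, 39, 9), (7, 34, 17), (11, 27, 15),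
    (14, 21, 22), (19, 10, 23), (25, 1, 30)]⟩),
  (121, ⟨[], [], [(1, 40, 11), (3, 18, 39), (4, 19, 24), (6, 20, 29), (8, 38, 10), (9, 33, 12),
    (13, 2, 35), (14, 16, 28), (17, 5, 31), (25, 7, 27)]⟩),
  (125, ⟨[(17, 4)], [], [(1, 43, 6), (2, 27, 18), (3, 36, 19), (5, 30, 26), (7, 31, 22),
    (9, 33, 15), (10, 41, 11), (13, 21, 25), (14, 23, 17)]⟩),
  (127, ⟨[(19, 4)], [], [(1, 33, 11), (2, 29, 23), (3, 35, 22), (5, 46, 7), (6, 41, 14),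
    (9, 40, 10), (15, 27, 21), (17, 13, 26), (19, 18, 25)]⟩),
  (131, ⟨[(23, 4)], [], [(1, 57, 2), (3, 34, 17), (6, 39, 10), (7, 31, 25), (9, 26, 27),
    (11, 19, 22), (13, 33, 15), (14, 29, 21), (18, 5, 42)]⟩),
  (137, ⟨[(17, 4)], [], [(1, 46, 9), (2, 52, 10), (3, 34, 23), (5, 35, 26), (6, 39, 14),
    (7, 36, 15), (17, 27, 21), (18, 31, 19), (22, 11, 30), (25, 13, 29)]⟩),
  (139, ⟨[(19, 4)], [], [(1, 39, 26), (3, 50, 5), (6, 35, 21), (7, 31, 29), (9, 33, 19),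
    (10, 27, 22), (11, 43, 14), (13, 34, 17), (15, 30, 18), (23, 2, 44)]⟩),
  (141, ⟨[(21, 4)], [], [(1, 45, 19), (2, 52, 9), (3, 47, 6), (5, 43, 14), (7, 42, 17),
    (10, 27, 31), (15, 26, 29), (18, 21, 30), (22, 13, 25), (23, 11, 33)]⟩),
  (147, ⟨[(19, 5)], [(4, 8, 48, 6)], [(1, 36, 16), (2, 49, 18), (3, 58, 7), (9, 32, 23),
    (11, 31, 28), (14, 24, 33), (17, 27, 19), (22, 21, 29), (26, 13, 34)]⟩),
  (149, ⟨[(17, 5)], [], [(1, 51, 8), (2, 37, 16), (3, 43, 18), (4, 45, 17), (6, 57, 11),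
    (7, 21, 44), (9, 32, 26), (13, 29, 27), (19, 31, 23), (22, 12, 36), (24, 14, 33)]⟩),
  (151, ⟨[(19, 5)], [], [(1, 63, 8), (2, 47, 19), (3, 51, 4), (6, 36, 23), (7, 41, 9),
    (11, 22, 34), (12, 17, 44), (13, 24, 38), (14, 32, 28), (16, 27, 26), (18, 21, 31)]⟩),
  (161, ⟨[(17, 7)], [], [(1, 32, 27), (2, 70, 6), (3, 37, 18), (4, 12, 52), (5, 48, 13),
    (8, 36, 31), (9, 41, 24), (10, 47, 22), (15, 23, 39), (17, 29, 34), (19, 11, 43),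
    (20, 25, 26)]⟩),
  (163, ⟨[(19, 5)], [], [(1, 61, 14), (2, 37, 31), (3, 54, 24), (4, 46, 23), (6, 53, 13),
    (7, 49, 11), (8, 44, 19), (9, 27, 28), (12, 22, 43), (21, 17, 41), (26, 16, 32),
    (29, 18, 33)]⟩),
  (167, ⟨[(23, 5)], [], [(1, 43, 33), (3, 26, 52), (4, 56, 9), (6, 61, 12), (7, 46, 22),
    (8, 23, 49), (11, 47, 16), (13, 38, 19), (14, 27, 21), (17, 42, 24), (18, 36, 28),
    (32, 2, 37)]⟩),
  (177, ⟨[(21, 6)], [], [(1, 56, 19), (2, 33, 46), (3, 47, 20), (4, 9, 59), (5, 64, 14),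
    (7, 37, 40), (8, 31, 43), (10, 11, 52), (15, 38, 27), (17, 49, 22), (23, 28, 34), (25, 16, 45),
    (29, 26, 32)]⟩),
  (179, ⟨[(23, 7)], [], [(1, 53, 29), (2, 57, 15), (3, 40, 46), (4, 64, 17), (5, 27, 52),
    (6, 10, 55), (8, 33, 34), (9, 30, 48), (11, 26, 25), (12, 38, 23), (18, 13, 45), (19, 47, 22),
    (20, 24, 36)]⟩),
  (181, ⟨[], [], [(3, 52, 24), (4, 34, 11), (5, 66, 7), (6, 33, 47), (9, 50, 25), (10, 44, 20),
    (12, 17, 60), (14, 37, 30), (15, 41, 31), (16, 46, 23), (18, 8, 57), (19, 2, 61), (22, 36, 32),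
    (27, 1, 42), (35, 13, 40)]⟩),
  (191, ⟨[(23, 7)], [], [(2, 60, 23), (3, 73, 13), (4, 47, 27), (6, 53, 22), (8, 26, 58),
    (11, 61, 18), (15, 33, 32), (19, 12, 57), (20, 17, 50), (24, 5, 66), (25, 16, 52),
    (30, 10, 54), (36, 9, 46), (38, 1, 43)]⟩),
  (197, ⟨[(17, 10)], [], [(1, 24, 71), (2, 47, 38), (3, 42, 48), (5, 39, 19), (7, 66, 13),
    (8, 6, 78), (9, 53, 12), (11, 46, 31), (15, 21, 61), (16, 52, 23), (17, 37, 27), (18, 41, 35),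
    (22, 34, 33), (26, 43, 29), (28, 4, 51)]⟩),
  (209, ⟨[(17, 10)], [], [(2, 86, 11), (3, 52, 22), (4, 53, 16), (5, 61, 32), (6, 85, 9),
    (7, 58, 31), (8, 75, 12), (13, 24, 35), (14, 42, 26), (19, 43, 41), (21, 17, 64), (23, 44, 34),
    (25, 46, 33), (27, 1, 48), (29, 18, 45), (36, 15, 39)]⟩),
  (211, ⟨[(19, 9)], [], [(1, 59, 43), (2, 65, 21), (3, 73, 19), (5, 77, 7), (8, 47, 38),
    (11, 39, 44), (13, 10, 68), (14, 56, 31), (15, 33, 57), (16, 25, 28), (20, 42, 37),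
    (22, 4, 71), (24, 6, 74), (32, 29, 35), (34, 17, 49), (40, 12, 46)]⟩),
  (229, ⟨[], [], [(1, 36, 77), (2, 70, 16), (3, 41, 35), (4, 59, 34), (5, 64, 21), (7, 31, 67),
    (8, 91, 9), (11, 78, 23), (12, 80, 14), (13, 43, 40), (19, 33, 32), (20, 54, 28), (22, 25, 62),
    (26, 24, 57), (27, 15, 53), (29, 17, 58), (30, 18, 55), (39, 10, 61), (45, 6, 60)]⟩),
  (237, ⟨[(21, 10)], [], [(2, 69, 44), (3, 43, 53), (5, 83, 28), (6, 55, 32), (7, 74, 31),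
    (9, 82, 13), (11, 8, 98), (15, 49, 45), (16, 59, 33), (17, 35, 51), (18, 67, 22), (23, 14, 65),
    (24, 39, 34), (25, 29, 47), (26, 1, 57), (36, 12, 66), (38, 4, 68), (41, 21, 56)]⟩),
  (261, ⟨[(21, 10)], [], [(1, 86, 42), (3, 109, 12), (4, 71, 33), (5, 39, 52), (8, 89, 26),
    (9, 73, 19), (11, 45, 58), (14, 7, 95), (15, 62, 43), (16, 63, 48), (17, 81, 32), (18, 6, 93),
    (22, 46, 38), (25, 28, 66), (29, 47, 31), (35, 34, 49), (36, 23, 51), (37, 27, 61),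
    (41, 13, 72), (55, 2, 65)]⟩),
  (267, ⟨[(19, 8)], [(9, 79, 10, 35)], [(1, 75, 36), (2, 82, 25), (3, 46, 67), (5, 42, 39),
    (11, 50, 41), (13, 80, 28), (14, 63, 38), (19, 51, 27), (20, 65, 34), (22, 83, 21),
    (23, 94, 12), (26, 18, 74), (30, 57, 33), (31, 96, 4), (37, 66, 29), (43, 17, 54),
    (52, 58, 15), (68, 55, 7), (69, 53, 6)]⟩),
  (279, ⟨[(19, 9)], [(47, 41, 39, 12)], [(1, 108, 28), (2, 105, 19), (3, 53, 37), (4, 75, 8),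
    (5, 55, 22), (6, 40, 70), (11, 89, 34), (13, 35, 67), (15, 104, 14), (16, 49, 57),
    (17, 84, 29), (20, 58, 33), (21, 64, 32), (24, 71, 43), (25, 61, 42), (26, 50, 44),
    (30, 68, 31), (38, 74, 23), (59, 66, 7), (69, 52, 10)]⟩),
  (281, ⟨[(17, 12)], [], [(1, 21, 90), (2, 55, 71), (3, 38, 86), (4, 42, 68), (6, 91, 39),
    (7, 87, 29), (10, 69, 50), (11, 59, 18), (13, 76, 26), (15, 34, 51), (17, 78, 30),
    (19, 63, 40), (23, 43, 32), (25, 92, 14), (27, 37, 56), (28, 45, 62), (31, 101, 8),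
    (35, 99, 5), (44, 9, 65), (52, 61, 20), (54, 67, 16), (58, 47, 33)]⟩),
  (309, ⟨[(21, 10)], [], [(2, 63, 31), (4, 72, 41), (5, 120, 13), (6, 77, 28), (7, 127, 18),
    (8, 66, 73), (9, 53, 75), (11, 98, 37), (12, 81, 29), (16, 39, 69), (17, 68, 64), (19, 52, 26),
    (21, 38, 48), (22, 104, 14), (23, 89, 42), (24, 58, 61), (25, 91, 32), (27, 114, 1),
    (33, 34, 54), (35, 57, 44), (43, 36, 51), (45, 84, 15), (47, 103, 3), (49, 46, 56)]⟩),
  (321, ⟨[(21, 10)], [], [(1, 63, 68), (2, 84, 65), (4, 79, 61), (5, 111, 23), (9, 8, 119),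
    (12, 93, 45), (14, 73, 72), (15, 38, 44), (16, 13, 75), (18, 96, 19), (21, 102, 33),
    (22, 52, 56), (24, 42, 76), (25, 95, 27), (28, 113, 11), (31, 94, 35), (32, 46, 39),
    (34, 67, 36), (43, 69, 41), (47, 81, 26), (49, 6, 71), (51, 58, 48), (54, 89, 3), (57, 91, 7),
    (59, 62, 37)]⟩),
  (333, ⟨[(21, 12)], [], [(2, 98, 49), (3, 101, 35), (4, 93, 25), (6, 111, 45), (7, 66, 15),
    (8, 59, 70), (9, 119, 14), (10, 79, 52), (11, 71, 75), (16, 135, 13), (19, 27, 64),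
    (20, 38, 57), (21, 42, 23), (22, 80, 43), (26, 90, 50), (29, 92, 34), (31, 83, 51),
    (33, 125, 5), (37, 39, 68), (40, 112, 1), (44, 17, 77), (47, 62, 41), (54, 78, 28),
    (55, 69, 30), (56, 87, 18), (74, 53, 32)]⟩),
  (359, ⟨[(23, 10)], [], [(1, 126, 49), (2, 93, 68), (3, 54, 83), (4, 99, 75), (7, 79, 52),
    (8, 6, 122), (12, 64, 37), (13, 85, 59), (15, 27, 81), (16, 89, 63), (17, 44, 72),
    (22, 132, 18), (23, 96, 46), (24, 117, 29), (25, 77, 41), (26, 94, 53), (31, 129, 19),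
    (32, 107, 38), (33, 78, 56), (34, 125, 5), (35, 47, 74), (39, 28, 84), (43, 48, 58),
    (51, 104, 11), (55, 69, 45), (62, 73, 36), (65, 88, 9), (66, 21, 71)]⟩),
  (379, ⟨[(7, 20)], [], [(1, 99, 71), (2, 47, 98), (3, 93, 53), (4, 132, 48), (6, 27, 77),
    (8, 89, 37), (9, 120, 15), (10, 140, 26), (11, 105, 63), (14, 138, 35), (16, 114, 45),
    (17, 92, 19), (21, 74, 65), (22, 142, 25), (24, 117, 36), (31, 127, 28), (34, 5, 118),
    (38, 81, 43), (41, 61, 76), (44, 46, 66), (54, 32, 83), (55, 52, 56), (57, 23, 68),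
    (58, 75, 50), (67, 18, 103), (69, 62, 51), (70, 12, 72), (73, 88, 13), (78, 87, 7),
    (79, 64, 42), (122, 29, 30)]⟩),
  (381, ⟨[], [(67, 35, 78, 10)], [(5, 148, 28), (6, 111, 19), (7, 166, 12), (13, 8, 139),
    (14, 115, 23), (15, 68, 48), (16, 60, 30), (17, 63, 69), (18, 161, 9), (20, 45, 89),
    (22, 77, 73), (26, 58, 56), (27, 52, 66), (29, 4, 122), (31, 55, 101), (32, 93, 42),
    (36, 64, 57), (38, 103, 34), (39, 119, 24), (41, 124, 3), (43, 61, 85), (49, 59, 51),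
    (53, 98, 11), (54, 74, 46), (70, 25, 82), (71, 62, 50), (72, 91, 1), (75, 94, 2), (97, 47, 40),
    (105, 37, 44)]⟩),
  (387, ⟨[(15, 17)], [], [(2, 126, 50), (7, 66, 44), (8, 90, 81), (9, 105, 38), (10, 138, 18),
    (11, 65, 55), (12, 109, 53), (13, 167, 3), (14, 118, 37), (15, 91, 54), (19, 22, 113),
    (21, 112, 28), (23, 64, 101), (25, 46, 88), (29, 48, 60), (30, 147, 4), (31, 96, 45),
    (32, 72, 78), (33, 130, 27), (36, 63, 86), (39, 1, 124), (42, 52, 59), (49, 35, 58),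
    (56, 6, 74), (57, 82, 47), (61, 83, 24), (67, 79, 43), (69, 89, 26), (70, 103, 20),
    (75, 100, 16), (95, 92, 5)]⟩),
  (407, ⟨[(15, 22)], [(109, 39, 4, 51)], [(5, 73, 52), (6, 160, 33), (7, 93, 23), (8, 20, 149),
    (9, 176, 2), (10, 76, 60), (11, 124, 48), (12, 59, 79), (13, 49, 102), (14, 89, 37),
    (15, 128, 25), (17, 96, 75), (19, 95, 72), (24, 139, 34), (26, 56, 119), (27, 134, 31),
    (29, 91, 50), (30, 117, 42), (32, 105, 53), (35, 127, 18), (38, 54, 64), (45, 61, 68),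
    (47, 16, 81), (69, 46, 87), (70, 85, 36), (74, 57, 65), (77, 104, 3), (83, 111, 1),
    (84, 58, 40), (90, 67, 41), (99, 80, 21)]⟩),
  (471, ⟨[(15, 29)], [], [(3, 117, 60), (6, 70, 89), (8, 128, 84), (12, 91, 24), (14, 74, 61),
    (15, 85, 47), (17, 184, 33), (18, 125, 39), (19, 176, 40), (21, 105, 62), (23, 9, 121),
    (25, 158, 46), (26, 202, 5), (28, 65, 68), (30, 82, 59), (31, 113, 56), (34, 193, 4),
    (37, 97, 75), (38, 181, 11), (44, 50, 79), (45, 77, 86), (48, 148, 27), (49, 90, 67),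
    (51, 99, 63), (52, 118, 20), (54, 98, 42), (55, 131, 35), (57, 53, 101), (64, 146, 22),
    (66, 119, 41), (69, 155, 1), (71, 108, 43), (72, 106, 36), (73, 10, 104), (78, 2, 109),
    (81, 124, 13), (92, 107, 16), (96, 95, 7)]⟩),
  (491, ⟨[(15, 29)], [(24, 70, 55, 96)], [(1, 158, 73), (3, 147, 25), (5, 230, 4), (7, 120, 69),
    (8, 123, 67), (9, 80, 84), (11, 165, 68), (12, 88, 78), (14, 209, 19), (15, 95, 107),
    (16, 185, 42), (17, 75, 63), (20, 98, 43), (21, 170, 50), (26, 154, 57), (27, 144, 53),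
    (30, 139, 56), (32, 83, 41), (34, 6, 106), (35, 101, 76), (38, 167, 33), (45, 148, 36),
    (46, 51, 102), (47, 140, 28), (49, 60, 72), (52, 111, 23), (54, 79, 81), (61, 157, 22),
    (62, 59, 71), (64, 44, 99), (65, 39, 90), (66, 86, 31), (74, 114, 48), (77, 105, 37),
    (82, 126, 2), (85, 119, 18), (91, 122, 13), (113, 93, 10)]⟩),
  (519, ⟨[(15, 30)], [], [(1, 208, 46), (2, 131, 80), (5, 108, 82), (6, 147, 49), (7, 116, 102),
    (11, 174, 65), (12, 139, 98), (13, 87, 57), (14, 115, 37), (18, 117, 32), (20, 207, 29),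
    (22, 112, 36), (23, 71, 51), (24, 119, 97), (25, 194, 39), (31, 73, 85), (38, 205, 16),
    (43, 199, 15), (44, 19, 99), (45, 81, 55), (47, 197, 9), (53, 125, 48), (54, 146, 41),
    (56, 50, 111), (59, 169, 17), (62, 93, 75), (64, 160, 28), (66, 172, 10), (68, 96, 58),
    (69, 132, 33), (70, 142, 34), (72, 175, 4), (74, 109, 21), (76, 101, 26), (77, 86, 35),
    (79, 114, 42), (83, 88, 52), (89, 95, 8), (91, 138, 3), (92, 67, 61), (107, 84, 40),
    (110, 27, 78)]⟩)]

/-- Entries `(g, s, d)`, where the gaps `1000 + e` in `d` stand for `L + e`. -/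
def extensionTable : List (ℕ × ℕ × Design) := [
  -- The block with gaps `1, L+1, 2` has the differences `1, 2, L+1, L+2, L+3, L+4`.
  (5, 4, ⟨[], [], [(1, 1001, 2)]⟩),
  (19, 15, ⟨[], [], [(1, 6, 1007), (2, 1003, 5), (3, 1001, 8), (4, 1002, 9)]⟩),
  (21, 16, ⟨[(5, 3)], [], [(1, 1003, 10), (2, 1005, 5), (4, 1002, 9), (7, 1001, 8)]⟩),
  (23, 19, ⟨[], [], [(1, 7, 1009), (2, 1001, 10), (3, 1004, 11), (4, 1002, 6), (5, 1005, 9)]⟩),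
  (25, 18, ⟨[], [], [(2, 1002, 12), (3, 1003, 7), (4, 1001, 10), (6, 5, 1007), (8, 1, 1008)]⟩),
  (27, 17, ⟨[], [], [(1, 1008, 5), (4, 8, 1003), (6, 1001, 9), (7, 3, 1002), (11, 2, 1004)]⟩),
  (29, 20, ⟨[], [(4, 1003, 6, 7)], [(1, 1005, 12), (2, 1002, 10), (5, 9, 1001), (8, 3, 1008)]⟩),
  (29, 22, ⟨[], [], [(1, 1010, 9), (3, 1005, 13), (4, 6, 1003), (5, 1001, 11), (7, 1007, 8),
    (12, 2, 1002)]⟩),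
  (29, 24, ⟨[(5, 3)], [], [(1, 1004, 13), (2, 1007, 14), (4, 1002, 10), (5, 1010, 9),
    (7, 1001, 12), (8, 1003, 11)]⟩),
  (29, 28, ⟨[], [], [(1, 1001, 6), (2, 1020, 4), (3, 1006, 12), (5, 1010, 13), (7, 1004, 8),
    (9, 1005, 11), (10, 1003, 14)]⟩),
  (31, 21, ⟨[], [], [(2, 1010, 8), (4, 1003, 10), (5, 1004, 7), (6, 9, 1006), (11, 3, 1005),
    (12, 1, 1001)]⟩),
  (31, 23, ⟨[(5, 2)], [], [(1, 1007, 8), (3, 1003, 14), (5, 1005, 13), (6, 9, 1004), (7, 1002, 12),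
    (10, 1001, 11)]⟩),
  (31, 24, ⟨[(7, 4)], [], [(1, 1006, 14), (2, 1001, 15), (3, 1005, 7), (5, 1009, 10),
    (6, 1004, 13), (9, 1002, 11)]⟩),
  (31, 27, ⟨[], [], [(1, 1022, 3), (2, 1005, 12), (4, 1004, 10), (5, 8, 1003), (6, 1006, 15),
    (7, 1002, 11), (9, 1001, 14)]⟩),
  (33, 22, ⟨[(5, 4)], [], [(1, 14, 1002), (2, 1005, 13), (3, 1006, 6), (7, 1004, 10),
    (9, 1001, 12), (11, 5, 1003)]⟩),
  (33, 24, ⟨[], [(5, 1004, 6, 9)], [(1, 1011, 11), (2, 8, 1006), (4, 1003, 14), (7, 1001, 12),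
    (13, 3, 1002)]⟩),
  (33, 30, ⟨[], [(11, 1003, 10, 6)], [(1, 1011, 15), (2, 1002, 4), (3, 1018, 7), (5, 1005, 12),
    (8, 1001, 14), (9, 1007, 13)]⟩),
  (35, 22, ⟨[(7, 5)], [], [(1, 1007, 7), (2, 14, 1002), (3, 1006, 13), (4, 1001, 12), (8, 1003, 9),
    (11, 6, 1004)]⟩),
  (35, 23, ⟨[], [(3, 13, 1, 1006)], [(2, 1003, 10), (4, 1010, 8), (5, 1004, 12), (6, 9, 1002),
    (7, 1001, 11)]⟩),
  (35, 27, ⟨[(5, 5)], [], [(1, 1002, 16), (2, 1010, 12), (3, 1008, 15), (4, 13, 1004),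
    (6, 1001, 8), (7, 1006, 14), (9, 1005, 11)]⟩),
  (35, 29, ⟨[], [(12, 1002, 2, 13)], [(1, 1007, 16), (3, 1018, 7), (5, 4, 1006), (6, 1003, 17),
    (8, 1005, 14), (10, 1001, 11)]⟩),
  (37, 24, ⟨[], [], [(1, 1006, 14), (2, 5, 1010), (4, 13, 1001), (8, 1004, 12), (9, 1002, 11),
    (10, 6, 1003), (15, 3, 1005)]⟩),
  (37, 26, ⟨[(5, 5)], [], [(2, 1005, 15), (3, 1001, 11), (4, 14, 1003), (6, 1010, 8),
    (7, 1006, 13), (9, 1002, 12), (16, 1, 1008)]⟩),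
  (37, 27, ⟨[(7, 5)], [], [(1, 1012, 13), (2, 1005, 9), (3, 1008, 12), (4, 1002, 16),
    (6, 11, 1004), (7, 1003, 14), (8, 1001, 18)]⟩),
  (37, 36, ⟨[], [], [(1, 1031, 2), (3, 1009, 15), (4, 1003, 18), (5, 1001, 13), (6, 1002, 9),
    (7, 1016, 12), (8, 1005, 17), (10, 1010, 16), (11, 1004, 14)]⟩),
  (39, 32, ⟨[(7, 5)], [], [(1, 1012, 11), (2, 1007, 19), (3, 1002, 6), (4, 1017, 8), (7, 1003, 17),
    (9, 1006, 16), (12, 1004, 14), (13, 1001, 18)]⟩),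
  (41, 24, ⟨[(5, 10)], [], [(1, 15, 1001), (2, 1006, 6), (4, 1009, 11), (5, 13, 1005),
    (7, 12, 1003), (8, 1002, 9), (14, 3, 1004)]⟩),
  (41, 32, ⟨[], [(10, 1008, 3, 11)], [(1, 1002, 12), (2, 17, 1009), (5, 1005, 20), (6, 1001, 16),
    (7, 1006, 18), (8, 1004, 15), (9, 4, 1016)]⟩)]

/-- Entries `(g, s, K)`, where the coordinates `±(1000 + e)` in `K` stand for `±(L + e)`. -/
def columnExtensionTable : List (ℕ × ℕ × List (ℤ × ℤ × ℤ)) := [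
  (7, 5, [(-1005, -1005, -2), (-1004, -1002, 0), (-1003, 2, -1002), (-1002, -1001, 3),
    (-1001, 1, -1004), (-3, -1004, -1005), (-2, 1002, 1), (-1, -3, -3), (0, 1003, 1001),
    (1, 0, -1003), (2, -1003, -1001), (3, 1004, 1005), (1001, -2, 1003), (1002, 1005, 1002),
    (1003, -1, 2), (1004, 1001, -1), (1005, 3, 1004)]),
  (7, 6, [(-1006, -1003, -2), (-1005, -2, -1006), (-1004, -3, -3), (-1003, 2, -1003),
    (-1002, 0, -1001), (-1001, -1004, 2), (-3, 1003, 1002), (-2, 1002, 1004), (-1, -1006, -1005),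
    (0, -1002, 3), (1, -1005, -1002), (2, -1001, -1004), (3, 1, 1005), (1001, 1001, -1),
    (1002, 1004, 1), (1003, -1, 1001), (1004, 3, 1006), (1005, 1006, 0), (1006, 1005, 1003)]),
  (13, 9, [(-1009, -1007, -5), (-1008, -3, -1004), (-1007, -5, -1009), (-1006, 2, -4),
    (-1005, 4, -1003), (-1004, -1008, -3), (-1003, -1005, 4), (-1002, -1001, 6), (-1001, 6, -1002),
    (-6, -1, 1003), (-5, -1009, -1007), (-4, -1006, 2), (-3, -1004, -1008), (-2, 1004, 1),
    (-1, 1003, -6), (0, 1001, 1005), (1, -2, 1004), (2, -4, -1006), (3, 1006, 1009),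
    (4, -1003, -1005), (5, 5, 5), (6, -1002, -1001), (1001, 1005, 0), (1002, 1008, 1007),
    (1003, -6, -1), (1004, 1, -2), (1005, 0, 1001), (1006, 1009, 3), (1007, 1002, 1008),
    (1008, 1007, 1002), (1009, 3, 1006)]),
  (13, 12, [(-1012, -1010, 0), (-1011, -1007, -5), (-1010, 0, -1012), (-1009, 3, -1008),
    (-1008, -1009, 3), (-1007, -5, -1011), (-1006, -1003, -2), (-1005, 1, -1001),
    (-1004, 5, -1002), (-1003, -2, -1006), (-1002, -1004, 5), (-1001, -1005, 1), (-6, 1005, -3),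
    (-5, -1011, -1007), (-4, 1001, 1006), (-3, -6, 1005), (-2, -1006, -1003), (-1, 1002, 1008),
    (0, -1012, -1010), (1, -1001, -1005), (2, 1009, 1003), (3, -1008, -1009), (4, 1012, 1007),
    (5, -1002, -1004), (6, 1010, 1011), (1001, 1006, -4), (1002, 1008, -1), (1003, 2, 1009),
    (1004, 1004, 1004), (1005, -3, -6), (1006, -4, 1001), (1007, 4, 1012), (1008, -1, 1002),
    (1009, 1003, 2), (1010, 1011, 6), (1011, 6, 1010), (1012, 1007, 4)]),
  (15, 11, [(-1011, -1011, -1011), (-1010, -1008, -6), (-1009, -4, -1006), (-1008, -6, -1010),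
    (-1007, -1002, 4), (-1006, -1009, -4), (-1005, -1004, 5), (-1004, 5, -1005), (-1003, 7, -1001),
    (-1002, 4, -1007), (-1001, -1003, 7), (-7, 1001, 0), (-6, -1010, -1008), (-5, 1, 1004),
    (-4, -1006, -1009), (-3, 1008, 2), (-2, 1002, 1005), (-1, 1006, 3), (0, -7, 1001),
    (1, 1004, -5), (2, -3, 1008), (3, -1, 1006), (4, -1007, -1002), (5, -1005, -1004),
    (6, 1007, 1011), (7, -1001, -1003), (1001, 0, -7), (1002, 1005, -2), (1003, 1010, 1009),
    (1004, -5, 1), (1005, -2, 1002), (1006, 3, -1), (1007, 1011, 6), (1008, 2, -3),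
    (1009, 1003, 1010), (1010, 1009, 1003), (1011, 6, 1007)]),
  (17, 14, [(-1014, -8, -1009), (-1013, -1007, -5), (-1012, -7, -1014), (-1011, -3, 2),
    (-1010, -1002, 1), (-1009, 1, -1003), (-1008, -1001, 4), (-1007, 7, -1005),
    (-1006, -1003, -1002), (-1005, -1012, -4), (-1004, -1, -1010), (-1003, -1011, -1),
    (-1002, -1008, 5), (-1001, 8, -1006), (-8, -1009, -1013), (-7, -1014, -1011),
    (-6, -1010, -1012), (-5, -1013, -2), (-4, 1009, 1001), (-3, 1004, 1011), (-2, 1010, 1004),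
    (-1, -4, 1002), (1, 1003, -3), (2, 1006, 1012), (3, 1014, 1007), (4, 1005, 1013),
    (5, 3, -1008), (6, -1006, -1004), (7, -1004, -1007), (8, -1005, -1001), (1001, -5, 1009),
    (1002, 1007, -6), (1003, 1002, -8), (1004, -6, 1003), (1005, 1001, -7), (1006, 4, 3),
    (1007, 2, 1014), (1008, 1012, 7), (1009, 6, 1010), (1010, 1011, 8), (1011, 1013, 1008),
    (1012, -2, 1005), (1013, 1008, 6), (1014, 5, 1006)])]

/-- Entries `(m, g, s)` for `m = g * n + 2 * s`, where `s = 0` indicates a product. -/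
def stepTable : List (ℕ × ℕ × ℕ) := [
  (13, 5, 4), (31, 13, 9), (45, 17, 14), (49, 19, 15), (53, 21, 16), (61, 23, 19), (65, 5, 0),
  (69, 29, 20), (73, 5, 4), (75, 5, 0), (79, 31, 24), (81, 33, 24), (85, 29, 28), (89, 35, 27),
  (93, 5, 4), (95, 5, 0), (101, 7, 5), (103, 5, 4), (105, 41, 32), (109, 37, 36), (113, 5, 4),
  (115, 5, 0), (119, 7, 0), (123, 5, 4), (129, 7, 5), (133, 5, 4), (135, 5, 0), (143, 5, 4),
  (145, 5, 0), (153, 5, 4), (155, 5, 0), (157, 7, 5), (159, 7, 6), (165, 5, 0), (169, 13, 0),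
  (171, 7, 5), (173, 5, 4), (175, 5, 0), (183, 5, 4), (185, 5, 0), (187, 13, 9), (189, 7, 0),
  (193, 5, 4), (195, 5, 0), (199, 7, 5), (201, 7, 6), (203, 5, 4), (205, 5, 0), (213, 5, 4),
  (215, 5, 0), (217, 7, 0), (221, 13, 0), (223, 5, 4), (225, 5, 0), (231, 7, 0), (233, 5, 4),
  (235, 5, 0), (239, 13, 9), (241, 7, 5), (245, 5, 0), (247, 13, 0), (253, 5, 4), (255, 5, 0),
  (259, 7, 0), (265, 5, 0), (269, 7, 5), (271, 7, 6), (273, 13, 0), (275, 5, 0), (277, 19, 15),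
  (283, 5, 4), (285, 5, 0), (287, 7, 0), (289, 17, 0), (291, 13, 9), (293, 5, 4), (295, 5, 0),
  (299, 13, 0), (301, 7, 0), (305, 5, 0), (307, 15, 11), (311, 7, 5), (313, 5, 4), (315, 5, 0),
  (323, 17, 0), (325, 13, 0), (329, 7, 0), (335, 5, 0), (337, 23, 19), (339, 7, 5), (341, 7, 6),
  (343, 7, 0), (345, 5, 0), (349, 13, 12), (351, 13, 0), (353, 5, 4), (355, 5, 0), (357, 17, 0),
  (361, 19, 0), (365, 5, 0), (371, 7, 0), (373, 5, 4), (375, 5, 0), (377, 13, 0), (385, 27, 17),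
  (389, 21, 16), (391, 17, 0), (393, 5, 4), (395, 5, 0), (397, 15, 11), (399, 19, 0),
  (403, 13, 0), (405, 5, 0), (409, 7, 5), (411, 7, 6), (413, 5, 4), (415, 5, 0), (417, 29, 20),
  (419, 17, 14), (421, 29, 22), (425, 17, 0), (427, 7, 0), (429, 13, 0), (433, 5, 4),
  (435, 5, 0), (437, 19, 0), (441, 21, 0), (443, 5, 4), (445, 31, 21), (447, 13, 9),
  (449, 31, 23), (451, 31, 24), (453, 17, 14), (455, 13, 0), (457, 31, 27), (459, 17, 0),
  (461, 25, 18), (463, 5, 4), (465, 5, 0), (467, 19, 15), (469, 7, 0), (473, 5, 4), (475, 19, 0),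
  (477, 33, 24), (479, 13, 12), (481, 13, 0), (483, 21, 0), (485, 5, 0), (487, 17, 14),
  (489, 33, 30), (493, 17, 0), (495, 5, 0), (497, 7, 0), (499, 35, 22), (501, 35, 23),
  (503, 5, 4), (505, 19, 15), (507, 13, 0), (509, 35, 27), (511, 25, 18), (513, 19, 0),
  (515, 5, 0), (517, 15, 11), (521, 23, 19), (523, 5, 4), (525, 21, 0), (527, 17, 0),
  (529, 23, 0), (531, 13, 12), (533, 13, 0), (535, 5, 0), (537, 29, 22), (539, 7, 0),
  (541, 29, 24), (543, 5, 4), (545, 5, 0), (547, 27, 17), (549, 29, 28), (551, 19, 0),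
  (553, 5, 4), (555, 5, 0), (557, 21, 16), (559, 13, 0), (561, 17, 0), (563, 5, 4), (565, 5, 0),
  (567, 21, 0), (569, 31, 21), (571, 39, 32), (573, 5, 4), (575, 23, 0), (577, 15, 11),
  (579, 7, 6), (581, 19, 15), (583, 13, 12), (585, 13, 0), (589, 17, 14), (591, 29, 20),
  (593, 5, 4), (595, 17, 0), (597, 41, 32), (599, 21, 16), (601, 27, 17), (603, 13, 9),
  (605, 5, 0), (607, 29, 28), (609, 21, 0), (611, 13, 0), (613, 5, 4), (615, 5, 0), (619, 7, 5),
  (621, 23, 0), (623, 5, 4), (625, 25, 0), (627, 19, 0), (629, 17, 0), (631, 31, 21),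
  (633, 5, 4), (635, 5, 0), (637, 13, 0), (639, 35, 22), (643, 5, 4), (645, 5, 0), (647, 7, 5),
  (649, 29, 20), (651, 7, 0), (653, 29, 22), (655, 27, 17), (657, 19, 15), (659, 23, 19),
  (661, 25, 18), (663, 17, 0), (665, 19, 0), (667, 23, 0), (671, 33, 22), (673, 5, 4),
  (675, 25, 0), (677, 37, 24), (679, 7, 0), (681, 37, 26), (683, 37, 27), (685, 5, 0),
  (687, 33, 30), (689, 13, 0), (691, 17, 14), (693, 21, 0), (695, 19, 15), (697, 17, 0),
  (699, 31, 24), (701, 37, 36), (703, 19, 0), (705, 23, 19), (707, 29, 20), (709, 27, 17),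
  (711, 25, 18), (713, 5, 4), (715, 13, 0), (721, 7, 0), (723, 5, 4), (725, 25, 0),
  (727, 39, 32), (729, 27, 0), (731, 17, 0), (733, 19, 15), (735, 21, 0), (737, 33, 22),
  (739, 13, 12), (741, 13, 0), (743, 5, 4), (745, 5, 0), (747, 7, 6), (749, 7, 0), (751, 37, 24),
  (753, 5, 4), (755, 31, 21), (757, 37, 27), (759, 23, 0), (761, 25, 18), (763, 5, 4),
  (765, 17, 0), (767, 13, 0), (769, 29, 22), (771, 19, 15), (773, 5, 4), (775, 37, 36),
  (777, 21, 0), (779, 19, 0), (781, 29, 28), (783, 27, 0), (785, 5, 0), (787, 7, 5), (791, 7, 0),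
  (793, 13, 0), (795, 5, 0), (797, 23, 19), (799, 17, 0), (801, 7, 5), (803, 33, 22),
  (805, 23, 0), (807, 33, 24), (809, 19, 15), (811, 13, 9), (813, 5, 4), (815, 5, 0),
  (817, 19, 0), (819, 21, 0), (821, 31, 23), (823, 5, 4), (825, 25, 0), (827, 29, 22),
  (829, 31, 27), (831, 29, 24), (833, 17, 0), (835, 5, 0), (837, 27, 0), (839, 29, 28),
  (841, 29, 0), (843, 5, 4), (845, 5, 0), (847, 19, 15), (849, 37, 36), (851, 23, 0),
  (853, 5, 4), (855, 19, 0), (857, 7, 5), (859, 35, 27), (861, 21, 0), (863, 35, 29),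
  (865, 5, 0), (867, 17, 0), (869, 33, 22), (871, 13, 0), (873, 5, 4), (875, 25, 0),
  (877, 15, 11), (879, 31, 21), (881, 29, 20), (883, 31, 23), (885, 19, 15), (887, 7, 6),
  (889, 23, 19), (891, 27, 0), (893, 19, 0), (895, 5, 0), (897, 13, 0), (899, 37, 24),
  (901, 17, 0), (903, 21, 0), (905, 5, 0), (907, 15, 11), (909, 41, 24), (911, 25, 18),
  (913, 5, 4), (915, 5, 0), (917, 7, 0), (919, 35, 22), (921, 35, 23), (923, 5, 4), (925, 25, 0),
  (927, 7, 5), (929, 35, 27), (931, 19, 0), (933, 35, 29), (935, 17, 0), (937, 15, 11),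
  (939, 33, 24), (941, 31, 21), (943, 23, 0), (945, 21, 0), (949, 13, 0), (951, 33, 30),
  (953, 31, 27), (955, 5, 0), (957, 29, 0), (959, 7, 0), (961, 19, 15), (963, 5, 4), (965, 5, 0),
  (967, 13, 9), (969, 17, 0), (973, 5, 4), (975, 25, 0), (979, 27, 17), (981, 23, 19),
  (983, 7, 5), (985, 5, 0), (987, 21, 0), (989, 23, 0), (991, 35, 23), (993, 5, 4), (995, 5, 0),
  (997, 29, 20), (999, 27, 0)]
/-! ### Existence -/

/-- Pass on `n`, evaluated. -/
def Nat.withValue {α : Type*} (n : ℕ) (f : ℕ → α) : α :=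
  -- The case distinction forces the kernel to evaluate `n` before going on, so that unevaluated
  -- masks do not pile up.
  Nat.casesOn n (f 0) fun p => f (p + 1)

theorem Nat.withValue_eq {α : Type*} (n : ℕ) (f : ℕ → α) : n.withValue f = f n := by
  cases n <;> rfl

namespace KnownOrders

/-- `List.foldl`, with evaluation of all intermediate results. -/
def fold {α : Type*} (f : KnownOrders → α → KnownOrders) : List α → KnownOrders → KnownOrders
  | [], k => k
  | a :: l, k => (f k a).perfect.withValue fun p => (f k a).pointed.withValue fun q =>
      fold f l ⟨p, q⟩

theorem fold_eq_foldl {α : Type*} (f : KnownOrders → α → KnownOrders) (l : List α)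
    (k : KnownOrders) : fold f l k = l.foldl f k := by
  induction l generalizing k with
  | nil => rfl
  | cons a l ih => rw [fold, Nat.withValue_eq, Nat.withValue_eq, ih, List.foldl_cons]

theorem Sound.fold {α : Type*} {f : KnownOrders → α → KnownOrders}
    (hf : ∀ k a, k.Sound → (f k a).Sound) (l : List α) {k : KnownOrders} (hk : k.Sound) :
    (fold f l k).Sound := by
  rw [fold_eq_foldl]
  exact hk.foldl hf l

/-- Add the order `m = g * n + 2 * s` as a product or by one of the extensions. -/
def addStep (k : KnownOrders) : ℕ × ℕ × ℕ → KnownOrders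
  -- A product is perfect. The extension by nothing, with the hole filled by `g` itself, records it
  -- as pointed if both factors are.
  | (m, g, 0) => addExtension m (addProduct m k g) (g, 0, ⟨[(g, 1)], [], []⟩)
  | (m, g, s + 1) =>
    (columnExtensionTable.filter fun e => e.1 == g && e.2.1 == s + 1).foldl (addColumnExtension m)
      ((extensionTable.filter fun e => e.1 == g && e.2.1 == s + 1).foldl (addExtension m) k)

theorem Sound.addStep {k : KnownOrders} (hk : k.Sound) (e : ℕ × ℕ × ℕ) : (k.addStep e).Sound := by
  obtain ⟨m, g, _ | s⟩ := e
  · exact (hk.addProduct m g).addExtension m _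
  · exact (hk.foldl (fun _ a h => h.addExtension m a) _).foldl
      (fun _ a h => h.addColumnExtension m a) _

/-- The orders provided by the tables. -/
def all : KnownOrders :=
  fold addStep stepTable (fold addDesign designTable (fold addColumns columnTable ⟨2, 2⟩))

theorem sound_all : all.Sound :=
  ((sound_one.fold (fun _ e h => h.addColumns e) _).fold (fun _ e h => h.addDesign e) _).fold
    (fun _ e h => h.addStep e) _

end KnownOrders

def exceptions : List ℕ :=
  [9, 11, 207, 219, 227, 243, 249, 251, 257, 263, 297, 303, 317, 319, 327, 331, 347, 363, 367, 369,
    383, 401, 423, 431, 439, 587, 617, 641, 669, 717, 719, 789, 947, 971, 977]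

/-- Apart from the exceptions, all odd orders from `5` to `999` are in the given mask. -/
def covers (p : ℕ) : Bool :=
  -- The last value is `2 * 497 + 5 = 999`.
  p.withValue fun p => (List.range 498).all fun n =>
    p.testBit (2 * n + 5) || exceptions.contains (2 * n + 5)

set_option maxRecDepth 100000 in
theorem covers_all : covers KnownOrders.all.perfect = true := by
  decide +kernel

theorem perfectOrder_of_notMem {m : ℕ} (hm : Odd m) (h5 : 5 ≤ m) (hlt : m < 1000)
    (he : m ∉ exceptions) : PerfectOrder m := by
  have h := covers_all
  rw [covers, Nat.withValue_eq] at h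
  obtain ⟨r, rfl⟩ := hm
  have := List.all_eq_true.1 h (r - 2) (List.mem_range.2 (by omega))
  rw [show 2 * (r - 2) + 5 = 2 * r + 1 by omega, Bool.or_eq_true, List.contains_iff_mem] at this
  exact (KnownOrders.sound_all.perfect _ (this.resolve_right he)).2

theorem theorem2p14 :
    (∀ m : ℕ, Odd m → 5 ≤ m → m < 1000 → m ∉ ({9, 11} : Finset ℕ) →
      m ∉ ({207, 219, 227, 243, 249, 251, 257, 263, 297, 303, 317, 319, 327, 331, 347, 363,
        367, 369, 383, 401, 423, 431, 439, 587, 617, 641, 669, 717, 719, 789, 947, 971,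
        977} : Finset ℕ) →
      ExistsPDM 3 m) ∧
    ¬ ExistsPDM 3 9 ∧ ¬ ExistsPDM 3 11 := by
  refine ⟨fun m hm h5 hlt h₁ h₂ => ?_, ?_, ?_⟩
  · refine (existsPDM_iff hm).2 (perfectOrder_of_notMem hm h5 hlt ?_)
    simp only [Finset.mem_insert, Finset.mem_singleton, not_or] at h₁ h₂
    simp only [exceptions, List.mem_cons, List.not_mem_nil, or_false, not_or]
    exact ⟨h₁.1, h₁.2, h₂⟩
  · rw [existsPDM_iff (by decide)]
    exact not_realizes_nine
  · rw [existsPDM_iff (by decide)]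
    exact not_realizes_eleven
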